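/- **Setting.** A separation algebra $\Sigma$ is a set with a partial commutative, associative, cancellative operation $*$ and a unit $e$. For $p,q\subseteq\Sigma$ let $p*q=\{\sigma_1*\sigma_2\mid \sigma_1\in p,\ \sigma_2\in q,\ \sigma_1*\sigma_2 \text{ defined}\}$. Let $\sigma_2\setminus\sigma_1$ be the unique $\sigma$ with $\sigma_2=\sigma*\sigma_1$, if it exists. A set $r\subseteq\Sigma$ is precise if every state $\sigma$ has at most one substate $\sigma_1\in r$ (i.e. $\sigma=\sigma_1*\sigma_2$ for some $\sigma_2$); then $\sigma\setminus r$ is the corresponding $\sigma_2$, if it exists. The footprint of $\sigma$ is $\delta(\sigma)=\{\sigma'\mid\forall\sigma''.\ (\sigma'*\sigma'')\text{ defined}\iff(\sigma*\sigma'')\text{ defined}\}$, and $l_1\preceq l_2$ means that $l_1=\delta(\sigma_1)$ and $l_2=\delta(\sigma_1*\sigma)$ for some $\sigma_1,\sigma$. Fix a separation algebra $\Sigma$ that is cancellative on footprints: if $\sigma_1*\sigma_2$ and $\sigma_1'*\sigma_2'$ are defined, $\delta(\sigma_1*\sigma_2)=\delta(\sigma'_1*\sigma'_2)$ and $\delta(\sigma_1)=\delta(\sigma'_1)$,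 then $\delta(\sigma_2)=\delta(\sigma_2')$. Threads are numbered $1,2,\dots$. Commands are $C::=c\mid m\mid C;C\mid C+C\mid C^*$, with primitive commands $c$ and method names $m$. Each primitive command $c$ and thread $t$ is interpreted by a map $f_c^t:\Sigma\to\mathcal P(\Sigma)\cup\{\top\}$ satisfying footprint preservation ($\sigma'\in f_c^t(\sigma)\Rightarrow\delta(\sigma')=\delta(\sigma)$) and strong locality (if $\sigma_1*\sigma_2$ is defined and $f_c^t(\sigma_1)\ne\top$, then $f_c^t(\sigma_1*\sigma_2)=f_c^t(\sigma_1)*\{\sigma_2\}$). A library $\mathcal L$ gives finitely many, and at least one, methods $m_1,\dots,m_j$ bodies that do not call methods. Its trace set consists of all prefixes of interleavings of traces of $k\ge1$ threads $1,\dots,k$, each running $(m_1+\dots+m_j)^*$; a call of $m$ by $t$ produces $(t,\mathsf{call}\,m)$, a trace of the body of $m$, and $(t,\mathsf{ret}\,m)$, and a primitive command $c$ run by $t$ produces $(t,c)$. A method specification $\Gamma$ gives each method $m$ in its domain a triple $\{p^m\}\,m\,\{q^m\}$ with $p^m_t,q^m_t\subseteq\Sigma$ precise for every thread $t$. In $\mathcal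 L:\Gamma$ all methods of $\mathcal L$ are in the domain of $\Gamma$. Evaluating a trace of $\mathcal L:\Gamma$ from a state executes its actions from left to right, nondeterministically and annotating calls and returns: $(t,c)$ leads from $\sigma$ to any $\sigma'\in f_c^t(\sigma)$ and faults if $f_c^t(\sigma)=\top$; $(t,\mathsf{call}\,m)$ leads from $\sigma$ to $\sigma*\sigma_p$, annotated as $(t,\mathsf{call}\,m(\sigma_p))$, for any $\sigma_p\in p^m_t$ such that $\sigma*\sigma_p$ is defined; $(t,\mathsf{ret}\,m)$ leads from $\sigma$ to $\sigma\setminus q_t^m$, annotated as $(t,\mathsf{ret}\,m(\sigma\setminus(\sigma\setminus q^m_t)))$, and faults if $\sigma\setminus q^m_t$ is undefined. If evaluating some trace of the library from $\sigma$ can fault, then $[\![\mathcal L:\Gamma]\!]\sigma=\top$; otherwise $[\![\mathcal L:\Gamma]\!]\sigma$ is the set of all annotated traces so obtained. $\mathcal L:\Gamma$ is safe for $I\subseteq\Sigma$ if $[\![\mathcal L:\Gamma]\!]\sigma\neq\top$ for all $\sigma\in I$. Let $\mathsf{history}(\lambda)$ be the subsequence of annotated calls and returns of $\lambda$. For histories,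 $H\sqsubseteq H'$ means that there is a bijection $\rho$ from the positions of $H$ to those of $H'$ with $H(i)=H'(\rho(i))$ for all $i$, and $\rho(i)<\rho(j)$ whenever $i<j$ and either $H(i),H(j)$ are by the same thread or $H(i)$ is a return and $H(j)$ is a call. We write $(\mathcal L_1:\Gamma,I_1)\sqsubseteq(\mathcal L_2:\Gamma,I_2)$ if for all $\sigma_1\in I_1$ and $\lambda_1\in[\![\mathcal L_1:\Gamma]\!]\sigma_1$ there are $\sigma_2\in I_2$ and $\lambda_2\in[\![\mathcal L_2:\Gamma]\!]\sigma_2$ with $\delta(\sigma_2)\preceq\delta(\sigma_1)$ and $\mathsf{history}(\lambda_1)\sqsubseteq\mathsf{history}(\lambda_2)$. A specification $\Gamma'=\{\{r^m\}\,m\,\{s^m\}\mid m\in M\}$ extends $\Gamma=\{\{p^m\}\,m\,\{q^m\}\mid m\in M\}$ if $r^m_t\subseteq p^m_t*\Sigma$ and $s^m_t\subseteq q^m_t*\Sigma$ for all $m\in M$ and all $t$. The history $\lceil H\rceil_\Gamma$ is obtained from $H$ by replacing each $(t,\mathsf{call}\,m(\sigma))$ by $(t,\mathsf{call}\,m(\sigma\setminus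 p^m_t))$ and each $(t,\mathsf{ret}\,m(\sigma))$ by $(t,\mathsf{ret}\,m(\sigma\setminus q^m_t))$. For a history $H$, $[\![H]\!]\sigma\in\Sigma\cup\{\top\}$ is obtained by starting with $\sigma$ and processing $H$ from left to right, replacing the current state $\theta$ by $\theta*\sigma_0$ at $(t,\mathsf{call}\,m(\sigma_0))$ and by $\theta\setminus\sigma_0$ at $(t,\mathsf{ret}\,m(\sigma_0))$; the result is $\top$ as soon as one of these is undefined. **Theorem (Frame rule for linearizability).** Let $\mathcal L_1,\mathcal L_2$ be libraries, $\Gamma,\Gamma'$ method specifications and $I_1,I_2,I\subseteq\Sigma$. Assume 1. $\Gamma'$ extends $\Gamma$; 2. for $i\in\{1,2\}$, $\mathcal L_i:\Gamma$ is safe for $I_i$ and $\mathcal L_i:\Gamma'$ is safe for $I_i*I$; 3. $(\mathcal L_1:\Gamma,I_1)\sqsubseteq(\mathcal L_2:\Gamma,I_2)$; and 4. for all $\sigma_0\in I_1$ and $\sigma_0'\in I$ with $\sigma_0*\sigma_0'$ defined, and all $\lambda\in[\![\mathcal L_1:\Gamma']\!](\sigma_0*\sigma'_0)$, we have $[\![\lceil\mathsf{history}(\lambda)\rceil_\Gamma]\!]\sigma_0'\neq\top$.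 Then $(\mathcal L_1:\Gamma',I_1*I)\sqsubseteq(\mathcal L_2:\Gamma',I_2*I)$. -/

import Mathlib

namespace OwnershipLin

universe u v w

/-! ### Separation algebras and footprints -/

/-- A separation algebra: a set with a partial commutative, associative and cancellative operation
(`op a b = none` means that the combination of `a` and `b` is undefined) and a unit. -/
class SepAlgebra (S : Type u) where
  op : S → S → Option S
  unit : S
  op_comm : ∀ a b, op a b = op b a
  op_assoc : ∀ a b c, (op a b).bind (fun x => op x c) = (op b c).bind (fun y => op a y)
  op_unit : ∀ a, op a unit = some a
  op_cancel : ∀ a b b' c, op a b = some c → op a b' = some c → b = b'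

open SepAlgebra (op)

section Algebra

variable {S : Type u} [SepAlgebra S]

/-- The combination of the two states is defined. -/
def Compatible (a b : S) : Prop := ∃ c, op a b = some c

/-- Pointwise lifting of the partial operation to sets of states. -/
def sepConj (p q : Set S) : Set S :=
  {σ | ∃ σ₁ ∈ p, ∃ σ₂ ∈ q, op σ₁ σ₂ = some σ}

open Classical in
/-- State subtraction: the state `σ` with `σ₂ = σ * σ₁`, if there is one. -/
noncomputable def sub (σ₂ σ₁ : S) : Option S :=
  if h : ∃ σ, op σ σ₁ = some σ₂ then some h.choose else none

theorem sub_eq_some_iff (σ₂ σ₁ σ : S) : sub σ₂ σ₁ = some σ ↔ op σ σ₁ = some σ₂ := by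
  unfold sub
  constructor
  · intro h
    split_ifs at h with hex
    cases h
    exact hex.choose_spec
  · intro h
    have hex : ∃ σ, op σ σ₁ = some σ₂ := ⟨σ, h⟩
    rw [dif_pos hex]
    congr 1
    have h1 := hex.choose_spec
    rw [SepAlgebra.op_comm] at h h1
    exact SepAlgebra.op_cancel _ _ _ _ h1 h

/-- A predicate is precise if every state has at most one substate satisfying it. -/
def Precise (r : Set S) : Prop :=
  ∀ σ σ₁ σ₁' σ₂ σ₂' : S, σ₁ ∈ r → σ₁' ∈ r →
    op σ₁ σ₂ = some σ → op σ₁' σ₂' = some σ → σ₁ = σ₁'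

open Classical in
/-- `subPred σ r` is the state remaining when the substate of `σ` that satisfies the precise
predicate `r` is removed; it is undefined if there is no such substate. -/
noncomputable def subPred (σ : S) (r : Set S) : Option S :=
  if h : ∃ σ₂, ∃ σ₁ ∈ r, op σ₁ σ₂ = some σ then some h.choose else none

theorem subPred_eq_some_iff {r : Set S} (hr : Precise r) (σ σ₂ : S) :
    subPred σ r = some σ₂ ↔ ∃ σ₁ ∈ r, op σ₁ σ₂ = some σ := by
  unfold subPred
  constructor
  · intro h
    split_ifs at h with hex
    cases h
    exact hex.choose_spec
  · rintro ⟨σ₁, h1, h2⟩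
    have hex : ∃ σ₂, ∃ σ₁ ∈ r, op σ₁ σ₂ = some σ := ⟨σ₂, σ₁, h1, h2⟩
    rw [dif_pos hex]
    congr 1
    obtain ⟨σ₁', h1', h2'⟩ := hex.choose_spec
    have e := hr _ _ _ _ _ h1 h1' h2 h2'
    subst e
    exact SepAlgebra.op_cancel _ _ _ _ h2' h2

/-- `subSat σ r` is the substate of `σ` satisfying the precise predicate `r`, computed as
`σ ∖ (σ ∖ r)`. -/
noncomputable def subSat (σ : S) (r : Set S) : Option S :=
  (subPred σ r).bind (fun σ' => sub σ σ')

/-- The footprint of a state. -/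
def footprint (σ : S) : Set S :=
  {σ' | ∀ σ'', Compatible σ' σ'' ↔ Compatible σ σ''}

/-- `FootSub l₂ l₁ l`: the subtraction of footprint `l₁` from footprint `l₂` is defined
and equals `l`. -/
def FootSub (l₂ l₁ l : Set S) : Prop :=
  ∃ σ₁ σ₂ σ : S, l₁ = footprint σ₁ ∧ l₂ = footprint σ₂ ∧ op σ₁ σ = some σ₂ ∧ l = footprint σ

/-- The order on footprints: `l₁` is smaller than `l₂` when subtracting `l₁` from `l₂`
is defined. -/
def FootLE (l₁ l₂ : Set S) : Prop := ∃ l, FootSub l₂ l₁ l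

end Algebra

/-- The operation of the separation algebra is cancellative on footprints. -/
def FootprintCancellative (S : Type u) [SepAlgebra S] : Prop :=
  ∀ σ₁ σ₂ σ₁' σ₂' σ σ' : S, op σ₁ σ₂ = some σ → op σ₁' σ₂' = some σ' →
    footprint σ = footprint σ' → footprint σ₁ = footprint σ₁' → footprint σ₂ = footprint σ₂'

/-! ### Actions, histories, linearizability of interface sets -/

/-- Thread identifiers `1, 2, 3, …`. -/
abbrev ThreadID : Type := ℕ+

/-- Interface actions `(t, call m(σ))` and `(t, ret m(σ))`. -/
inductive IAct (S : Type u) (M : Type v) where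
  | call (t : ThreadID) (m : M) (σ : S)
  | ret (t : ThreadID) (m : M) (σ : S)

namespace IAct

variable {S : Type u} {M : Type v}

def tid : IAct S M → ThreadID
  | call t _ _ => t
  | ret t _ _ => t

def IsCall : IAct S M → Prop
  | call _ _ _ => True
  | ret _ _ _ => False

def IsRet : IAct S M → Prop
  | call _ _ _ => False
  | ret _ _ _ => True

end IAct

/-- Actions without state annotations: `(t, c)`, `(t, call m)`, `(t, ret m)`. -/
inductive GAct (P : Type w) (M : Type v) where
  | prim (t : ThreadID) (c : P)
  | call (t : ThreadID) (m : M)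
  | ret (t : ThreadID) (m : M)

def GAct.tid {P : Type w} {M : Type v} : GAct P M → ThreadID
  | .prim t _ => t
  | .call t _ => t
  | .ret t _ => t

/-- Actions of annotated traces: `(t, c)` and interface actions. -/
inductive Act (S : Type u) (P : Type w) (M : Type v) where
  | prim (t : ThreadID) (c : P)
  | iface (ψ : IAct S M)

/-- The projection of an annotated trace to its calls and returns. -/
def history {S : Type u} {P : Type w} {M : Type v} (τ : List (Act S P M)) : List (IAct S M) :=
  τ.filterMap fun φ => match φ with
    | .prim _ _ => none
    | .iface ψ => some ψ

/-- The linearization relation on histories. -/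
def HistLin {S : Type u} {M : Type v} (H H' : List (IAct S M)) : Prop :=
  ∃ ρ : Fin H.length ≃ Fin H'.length, ∀ i j : Fin H.length,
    H.get i = H'.get (ρ i) ∧
    ((i < j ∧ ((H.get i).tid = (H.get j).tid ∨ ((H.get i).IsRet ∧ (H.get j).IsCall))) →
      ρ i < ρ j)

/-- The linearization relation on sets of pairs of an initial footprint and a history. -/
def InterfLin {S : Type u} [SepAlgebra S] {M : Type v}
    (X₁ X₂ : Set (Set S × List (IAct S M))) : Prop :=
  ∀ x₁ ∈ X₁, ∃ x₂ ∈ X₂, FootLE x₂.1 x₁.1 ∧ HistLin x₁.2 x₂.2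

/-! ### The programming language -/

/-- Commands `C ::= c | m | C; C | C + C | C*`. -/
inductive Comm (P : Type w) (M : Type v) where
  | prim (c : P)
  | call (m : M)
  | seq (C₁ C₂ : Comm P M)
  | choice (C₁ C₂ : Comm P M)
  | star (C : Comm P M)

namespace Comm

variable {P : Type w} {M : Type v}

/-- The command contains no method calls. -/
def CallFree : Comm P M → Prop
  | prim _ => True
  | call _ => False
  | seq C₁ C₂ => C₁.CallFree ∧ C₂.CallFree
  | choice C₁ C₂ => C₁.CallFree ∧ C₂.CallFree
  | star C => C.CallFree

/-- The trace set of a command executed by thread `t`, where `η m t` is the trace set of the body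
of method `m` executed by thread `t`. -/
def traces (t : ThreadID) (η : M → ThreadID → Language (GAct P M)) :
    Comm P M → Language (GAct P M)
  | prim c => ({[GAct.prim t c]} : Set (List (GAct P M)))
  | call m => {τ | ∃ τ₀ ∈ η m t, τ = [GAct.call t m] ++ τ₀ ++ [GAct.ret t m]}
  | seq C₁ C₂ => traces t η C₁ * traces t η C₂
  | choice C₁ C₂ => traces t η C₁ + traces t η C₂
  | star C => KStar.kstar (traces t η C)

/-- The nondeterministic choice `m₁ + … + mⱼ` of calls to the methods in a nonempty list. -/
def sumCalls : (l : List M) → l ≠ [] → Comm P M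
  | [], h => absurd rfl h
  | [m], _ => call m
  | m :: m' :: l, _ => choice (call m) (sumCalls (m' :: l) (List.cons_ne_nil m' l))

end Comm

/-- A library `{m₁ = C₁; …; mⱼ = Cⱼ}`; method bodies do not call methods. The values of `body`
outside the list of methods play no role. -/
structure Library (P : Type w) (M : Type v) where
  methods : List M
  methods_ne : methods ≠ []
  body : M → Comm P M
  body_callFree : ∀ m ∈ methods, (body m).CallFree

/-- `parallel k T` is the set of all interleavings of traces from `T 1, …, T k`. -/
def parallel {P : Type w} {M : Type v} (k : ℕ) (T : ThreadID → Language (GAct P M)) :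
    Set (List (GAct P M)) :=
  {τ | (∀ φ ∈ τ, (φ.tid : ℕ) ≤ k) ∧
    ∀ t : ThreadID, (t : ℕ) ≤ k → τ.filter (fun φ => decide (φ.tid = t)) ∈ T t}

/-- Prefix closure of a trace set. -/
def prefixes {A : Type*} (X : Set (List A)) : Set (List A) :=
  {τ | ∃ τ' ∈ X, τ <+: τ'}

namespace Library

variable {P : Type w} {M : Type v}

/-- The thread `(m₁ + … + mⱼ)*` of the most general client. -/
def mgc (L : Library P M) : Comm P M := Comm.star (Comm.sumCalls L.methods L.methods_ne)

/-- The trace sets of the method bodies (which do not depend on the last argument of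
`Comm.traces`, as bodies are call-free). -/
def bodyTraces (L : Library P M) (m : M) (t : ThreadID) : Language (GAct P M) :=
  (L.body m).traces t (fun _ _ => 0)

/-- The trace set of the library, run under its most general client. -/
def traceSet (L : Library P M) : Set (List (GAct P M)) :=
  prefixes (⋃ k : ℕ, ⋃ _ : 1 ≤ k, parallel k (fun t => L.mgc.traces t L.bodyTraces))

end Library

/-! ### Method specifications, primitive commands, library-local semantics -/

/-- A method specification: a triple of a precise parameterised precondition and a precise
parameterised postcondition for every method in `dom`, and none for the others. -/
structure MethodSpec (S : Type u) [SepAlgebra S] (M : Type v) where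
  dom : Set M
  pre : M → ThreadID → Set S
  post : M → ThreadID → Set S
  pre_precise : ∀ m ∈ dom, ∀ t, Precise (pre m t)
  post_precise : ∀ m ∈ dom, ∀ t, Precise (post m t)

/-- Every method of the library has a specification, so that the specified library `L : Γ`
makes sense. -/
def Specifies {S : Type u} [SepAlgebra S] {P : Type w} {M : Type v}
    (Γ : MethodSpec S M) (L : Library P M) : Prop :=
  ∀ m ∈ L.methods, m ∈ Γ.dom

/-- Sets with an additional error element `top`. -/
inductive Res (A : Type*) where
  | top
  | val (X : Set A)

/-- Membership in a result other than the error element. -/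
def Res.Has {A : Type*} (r : Res A) (a : A) : Prop :=
  match r with
  | .top => False
  | .val X => a ∈ X

/-- An interpretation of the primitive commands by transformers that preserve footprints and are
strongly local. -/
structure PrimSem (S : Type u) [SepAlgebra S] (P : Type w) where
  f : P → ThreadID → S → Res S
  footprint_preservation : ∀ c t (σ σ' : S), (f c t σ).Has σ' → footprint σ' = footprint σ
  strong_locality : ∀ c t (σ₁ σ₂ σ : S) (X : Set S), op σ₁ σ₂ = some σ →
    f c t σ₁ = .val X → f c t σ = .val (sepConj X {σ₂})

section Semantics

variable {S : Type u} [SepAlgebra S] {P : Type w} {M : Type v}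

open Classical in
/-- Library-local evaluation of an action. -/
noncomputable def evalAct (I : PrimSem S P) (Γ : MethodSpec S M) :
    GAct P M → S → Res (S × Act S P M)
  | .prim t c, σ =>
      match I.f c t σ with
      | .top => .top
      | .val X => .val {x | ∃ σ' ∈ X, x = (σ', Act.prim t c)}
  | .call t m, σ =>
      .val {x | ∃ σp ∈ Γ.pre m t, ∃ σ', op σ σp = some σ' ∧
        x = (σ', Act.iface (IAct.call t m σp))}
  | .ret t m, σ =>
      if subPred σ (Γ.post m t) = none then .top
      else .val {x | ∃ σ' σq, subPred σ (Γ.post m t) = some σ' ∧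
        subSat σ (Γ.post m t) = some σq ∧ x = (σ', Act.iface (IAct.ret t m σq))}

open Classical in
/-- One step of trace evaluation: extends the evaluation of a trace by one action. -/
noncomputable def evalStep (I : PrimSem S P) (Γ : MethodSpec S M)
    (r : Res (S × List (Act S P M))) (φ : GAct P M) : Res (S × List (Act S P M)) :=
  match r with
  | .top => .top
  | .val X =>
      if ∃ x ∈ X, evalAct I Γ φ x.1 = .top then .top
      else .val {y | ∃ x ∈ X, ∃ z, (evalAct I Γ φ x.1).Has z ∧ y = (z.1, x.2 ++ [z.2])}

/-- Library-local evaluation of a trace from a state. -/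
noncomputable def evalTrace (I : PrimSem S P) (Γ : MethodSpec S M)
    (τ : List (GAct P M)) (σ : S) : Res (S × List (Act S P M)) :=
  τ.foldl (evalStep I Γ) (.val {(σ, [])})

open Classical in
/-- The denotation of the specified library `L : Γ` at an initial state. -/
noncomputable def denot (I : PrimSem S P) (L : Library P M) (Γ : MethodSpec S M) (σ : S) :
    Res (List (Act S P M)) :=
  if ∃ τ ∈ L.traceSet, evalTrace I Γ τ σ = .top then .top
  else .val {τ' | ∃ τ ∈ L.traceSet, ∃ σ', (evalTrace I Γ τ σ).Has (σ', τ')}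

/-- `L : Γ` is safe for the set `Init` of initial states. -/
def SafeFor (I : PrimSem S P) (L : Library P M) (Γ : MethodSpec S M) (Init : Set S) : Prop :=
  ∀ σ ∈ Init, denot I L Γ σ ≠ .top

/-- The interface set of `L : Γ` run from the initial states in `Init`. -/
def interf (I : PrimSem S P) (L : Library P M) (Γ : MethodSpec S M) (Init : Set S) :
    Set (Set S × List (IAct S M)) :=
  {x | ∃ σ₀ ∈ Init, ∃ τ, (denot I L Γ σ₀).Has τ ∧ x = (footprint σ₀, history τ)}

/-- `(L₁ : Γ, I₁)` is linearized by `(L₂ : Γ, I₂)`. -/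
def LinearizedBy (I : PrimSem S P) (Γ : MethodSpec S M)
    (L₁ : Library P M) (I₁ : Set S) (L₂ : Library P M) (I₂ : Set S) : Prop :=
  InterfLin (interf I L₁ Γ I₁) (interf I L₂ Γ I₂)

/-! ### Extension of specifications and the extra state in histories -/

/-- `Γ'` extends `Γ`. -/
def Extends (Γ' Γ : MethodSpec S M) : Prop :=
  Γ'.dom = Γ.dom ∧ ∀ m ∈ Γ.dom, ∀ t,
    Γ'.pre m t ⊆ sepConj (Γ.pre m t) Set.univ ∧ Γ'.post m t ⊆ sepConj (Γ.post m t) Set.univ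

/-- The part of the state in an interface action that is not required by `Γ`. -/
noncomputable def extraAct (Γ : MethodSpec S M) : IAct S M → Option (IAct S M)
  | .call t m σ => (subPred σ (Γ.pre m t)).map (IAct.call t m)
  | .ret t m σ => (subPred σ (Γ.post m t)).map (IAct.ret t m)

/-- The lifting of `extraAct` to histories, undefined if it is undefined on some action. -/
noncomputable def extraHist (Γ : MethodSpec S M) (H : List (IAct S M)) :
    Option (List (IAct S M)) :=
  H.mapM (extraAct Γ)

/-- Evaluation of an interface action recording extra state; `none` is the error element. -/
noncomputable def evalIAct (σ : S) : IAct S M → Option S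
  | .call _ _ σ₀ => op σ σ₀
  | .ret _ _ σ₀ => sub σ σ₀

/-- Evaluation of a history recording extra state; `none` is the error element. -/
noncomputable def evalHist (H : List (IAct S M)) (σ : S) : Option S :=
  H.foldlM evalIAct σ

end Semantics

end OwnershipLin

open OwnershipLin

namespace OwnershipLin

universe u v w

open OwnershipLin.SepAlgebra (op)

/-! ### The partial monoid as a monoid with an absorbing element -/

section Algebra

variable {S : Type u} [SepAlgebra S]

/-! A run of `L₁` under `Γ'` from `σ₁ * E` can be split. Safety under `Γ` and strong locality
confine primitive commands to the `Γ`-part of the state, precision of the postconditions determines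
what a return takes from that part, and the hypothesis on extra histories accounts for the rest.
`Run.exists_base` thus yields a run under `Γ` from `σ₁`, and `SplitEval` remembers how the two parts
evolve. By assumption some run of `L₂` under `Γ` linearizes its history.

The extra state moves in the order of the history of `L₁`, so the run of `L₂` is first rearranged to
have exactly that history: calls are moved earlier and returns are postponed. Thread projections do
not change, so the result is still a trace of `L₂`. However, an early call or a late return keeps
state around longer, and the combination may be undefined. `PieceRun` therefore drops compatibility:
it executes on loose pieces, where both moves are harmless (`PieceRun.remove_call`,
`PieceRun.delay_ret`, combined in `PieceRun.exists_rearrangement`).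

Compatibility is recovered from the run of `L₁` in `PieceRun.exists_run`. The product `σ` of the
pieces, combined with a fixed remainder `z`, always has the footprint of the current state `θ` of
`L₁`. Since `θ` is compatible with the extra state `E`, so is `σ`. Primitive commands preserve this
because they preserve footprints, calls because footprints are a congruence, and returns by
cancellativity on footprints. The resulting run of `L₂` under `Γ'` has the same history as the given
run of `L₁`. -/

instance optionCommMonoid : CommMonoid (Option S) where
  mul x y := x.bind fun a => y.bind fun b => op a b
  one := some SepAlgebra.unit
  mul_assoc x y z := by
    rcases x with _ | a
    · rfl
    rcases y with _ | b
    · rfl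
    rcases z with _ | c
    · change (op a b).bind (fun _ => none) = none
      cases op a b <;> rfl
    · exact SepAlgebra.op_assoc a b c
  mul_comm x y := by
    rcases x with _ | a <;> rcases y with _ | b
    · rfl
    · rfl
    · rfl
    · exact SepAlgebra.op_comm a b
  one_mul x := by
    rcases x with _ | a
    · rfl
    · exact (SepAlgebra.op_comm _ a).trans (SepAlgebra.op_unit a)
  mul_one x := by
    rcases x with _ | a
    · rfl
    · exact SepAlgebra.op_unit a

theorem some_mul_some (a b : S) : (some a * some b : Option S) = op a b := rfl

theorem none_mul (x : Option S) : (none * x : Option S) = none := rfl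

theorem mul_none (x : Option S) : (x * none : Option S) = none := by
  rw [mul_comm, none_mul]

/-- Since `none` is absorbing, compatibility of parts follows by regrouping a product already known
to be defined; most definedness claims below are obtained this way. -/
theorem exists_of_mul_eq_some {x y : Option S} {c : S} (h : x * y = some c) :
    ∃ a b, x = some a ∧ y = some b ∧ op a b = some c := by
  rcases x with _ | a
  · rw [none_mul] at h; cases h
  rcases y with _ | b
  · rw [mul_none] at h; cases h
  exact ⟨a, b, rfl, rfl, h⟩

/-- Cancellation holds only for defined products, hence the common value `some c`. -/
theorem mul_left_cancel_of_eq_some {a c : S} {x y : Option S} (hx : some a * x = some c)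
    (hy : some a * y = some c) : x = y := by
  obtain ⟨_, b, e, rfl, h⟩ := exists_of_mul_eq_some hx
  obtain ⟨_, b', e', rfl, h'⟩ := exists_of_mul_eq_some hy
  cases e; cases e'
  rw [SepAlgebra.op_cancel _ _ _ _ h h']

theorem mem_footprint_self (σ : S) : σ ∈ footprint σ := fun _ => Iff.rfl

theorem compatible_iff_of_footprint_eq {a a' : S} (h : footprint a = footprint a') (b : S) :
    Compatible a b ↔ Compatible a' b := by
  have : a ∈ footprint a' := h ▸ mem_footprint_self a
  exact this b

theorem footprint_eq_of_compatible_iff {a a' : S} (h : ∀ b, Compatible a b ↔ Compatible a' b) :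
    footprint a = footprint a' := by
  ext σ
  exact ⟨fun hσ b => (hσ b).trans (h b), fun hσ b => (hσ b).trans (h b).symm⟩

theorem compatible_op_iff {a b c : S} (h : op a b = some c) (x : S) :
    Compatible c x ↔ ∃ y, op b x = some y ∧ Compatible a y := by
  constructor
  · rintro ⟨d, hd⟩
    have e : (some a * (some b * some x) : Option S) = some d := by
      rw [← mul_assoc, some_mul_some a b, h]; exact hd
    obtain ⟨_, y, e₁, hy, hd'⟩ := exists_of_mul_eq_some e
    cases e₁
    exact ⟨y, hy, d, hd'⟩
  · rintro ⟨y, hy, d, hd⟩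
    refine ⟨d, ?_⟩
    rw [← some_mul_some, ← h, ← some_mul_some, mul_assoc, some_mul_some b, hy]
    exact hd

/-- Footprint equality is a congruence: by associativity, what `a * b` is compatible with depends on
`a` only through what `a` is compatible with. -/
theorem exists_op_of_footprint_eq {a a' b c : S} (hf : footprint a = footprint a')
    (h : op a b = some c) : ∃ c', op a' b = some c' ∧ footprint c = footprint c' := by
  obtain ⟨c', hc'⟩ := (compatible_iff_of_footprint_eq hf b).1 ⟨c, h⟩
  refine ⟨c', hc', footprint_eq_of_compatible_iff fun x => ?_⟩
  rw [compatible_op_iff h, compatible_op_iff hc']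
  simp only [compatible_iff_of_footprint_eq hf]

theorem exists_mem_of_subPred_eq_some {r : Set S} {σ σ' : S} (h : subPred σ r = some σ') :
    ∃ g ∈ r, op g σ' = some σ := by
  unfold subPred at h
  split_ifs at h with hex
  cases h
  exact hex.choose_spec

theorem subSat_eq_some {r : Set S} {g σ σ' : S} (h : subPred σ r = some σ')
    (hg : op g σ' = some σ) : subSat σ r = some g := by
  unfold subSat
  rw [h]
  exact (sub_eq_some_iff _ _ _).2 hg

theorem mem_of_subSat_eq_some {r : Set S} {g σ σ' : S} (h : subPred σ r = some σ')
    (hg : subSat σ r = some g) : g ∈ r ∧ op g σ' = some σ := by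
  obtain ⟨g', hg', e⟩ := exists_mem_of_subPred_eq_some h
  rw [subSat_eq_some h e] at hg
  cases hg
  exact ⟨hg', e⟩

end Algebra

/-! ### Evaluation as a transition relation -/

section Run

variable {S : Type u} [SepAlgebra S] {P : Type w} {M : Type v}

/-- The action without its state annotation. -/
def Act.erase : Act S P M → GAct P M
  | .prim t c => .prim t c
  | .iface (.call t m _) => .call t m
  | .iface (.ret t m _) => .ret t m

/-- No evaluation of the trace from the state faults. -/
def SafeFrom (F : PrimSem S P) (Γ : MethodSpec S M) : List (GAct P M) → S → Prop
  | [], _ => True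
  | φ :: τ, σ => evalAct F Γ φ σ ≠ .top ∧
      ∀ z, (evalAct F Γ φ σ).Has z → SafeFrom F Γ τ z.1

/-- The annotated trace is one of the results of evaluating its erasure from the state. -/
def Run (F : PrimSem S P) (Γ : MethodSpec S M) : List (Act S P M) → S → Prop
  | [], _ => True
  | φ :: τ, σ => ∃ σ', (evalAct F Γ φ.erase σ).Has (σ', φ) ∧ Run F Γ τ σ'

variable {F : PrimSem S P} {Γ : MethodSpec S M}

theorem evalAct_prim_has {t : ThreadID} {c : P} {σ : S} {z : S × Act S P M} :
    (evalAct F Γ (.prim t c) σ).Has z ↔ (F.f c t σ).Has z.1 ∧ z.2 = .prim t c := by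
  obtain ⟨σ', φ⟩ := z
  simp only [evalAct]
  cases F.f c t σ with
  | top => simp [Res.Has]
  | val X => simp [Res.Has]

theorem evalAct_call_has {t : ThreadID} {m : M} {σ : S} {z : S × Act S P M} :
    (evalAct F Γ (.call t m) σ).Has z ↔
      ∃ g ∈ Γ.pre m t, op σ g = some z.1 ∧ z.2 = .iface (.call t m g) := by
  obtain ⟨σ', φ⟩ := z
  simp only [evalAct, Res.Has, Set.mem_ofPred_eq, Prod.mk.injEq]
  constructor
  · rintro ⟨g, hg, _, h, rfl, rfl⟩
    exact ⟨g, hg, h, rfl⟩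
  · rintro ⟨g, hg, h, rfl⟩
    exact ⟨g, hg, _, h, rfl, rfl⟩

/-- The equation for `subPred` is kept next to the decomposition because, without precision, the
decomposition does not determine which remainder was chosen. -/
theorem evalAct_ret_has {t : ThreadID} {m : M} {σ : S} {z : S × Act S P M} :
    (evalAct F Γ (.ret t m) σ).Has z ↔ ∃ g ∈ Γ.post m t, subPred σ (Γ.post m t) = some z.1 ∧
      op g z.1 = some σ ∧ z.2 = .iface (.ret t m g) := by
  obtain ⟨σ', φ⟩ := z
  simp only [evalAct]
  split_ifs with h
  · simp [Res.Has, h]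
  · simp only [Res.Has, Set.mem_ofPred_eq, Prod.mk.injEq]
    constructor
    · rintro ⟨_, g, h₁, h₂, rfl, rfl⟩
      obtain ⟨hg, e⟩ := mem_of_subSat_eq_some h₁ h₂
      exact ⟨g, hg, h₁, e, rfl⟩
    · rintro ⟨g, _, h₁, h₂, rfl⟩
      exact ⟨_, g, h₁, subSat_eq_some h₁ h₂, rfl, rfl⟩

theorem erase_of_evalAct_has {φ : GAct P M} {σ : S} {z : S × Act S P M}
    (h : (evalAct F Γ φ σ).Has z) : z.2.erase = φ := by
  cases φ with
  | prim t c => rw [(evalAct_prim_has.1 h).2]; rfl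
  | call t m => obtain ⟨_, _, _, e⟩ := evalAct_call_has.1 h; rw [e]; rfl
  | ret t m => obtain ⟨_, _, _, _, e⟩ := evalAct_ret_has.1 h; rw [e]; rfl

theorem foldl_evalStep_top (τ : List (GAct P M)) :
    τ.foldl (evalStep F Γ) .top = .top := by
  induction τ with
  | nil => rfl
  | cons φ τ ih => exact ih

theorem safeFrom_of_foldl_ne_top (τ : List (GAct P M)) (X : Set (S × List (Act S P M)))
    (h : τ.foldl (evalStep F Γ) (.val X) ≠ .top) : ∀ x ∈ X, SafeFrom F Γ τ x.1 := by
  induction τ generalizing X with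
  | nil => exact fun _ _ => trivial
  | cons φ τ ih =>
    intro x hx
    rw [List.foldl_cons, evalStep] at h
    split_ifs at h with hf
    · exact absurd (foldl_evalStep_top τ) h
    · exact ⟨fun e => hf ⟨x, hx, e⟩, fun z hz => ih _ h _ ⟨x, hx, z, hz, rfl⟩⟩

theorem foldl_evalStep_has_iff (τ : List (GAct P M)) (X : Set (S × List (Act S P M)))
    (h : τ.foldl (evalStep F Γ) (.val X) ≠ .top) (ρ : List (Act S P M)) :
    (∃ σ', (τ.foldl (evalStep F Γ) (.val X)).Has (σ', ρ)) ↔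
      ∃ x ∈ X, ∃ ρ', ρ = x.2 ++ ρ' ∧ ρ'.map Act.erase = τ ∧ Run F Γ ρ' x.1 := by
  induction τ generalizing X with
  | nil =>
    simp only [List.foldl_nil, Res.Has, List.map_eq_nil_iff]
    constructor
    · rintro ⟨σ', hσ'⟩
      exact ⟨_, hσ', [], by simp, rfl, trivial⟩
    · rintro ⟨⟨σ', ρ₀⟩, hx, _, rfl, rfl, _⟩
      exact ⟨σ', by simpa using hx⟩
  | cons φ τ ih =>
    rw [List.foldl_cons, evalStep] at h ⊢
    split_ifs at h ⊢ with hf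
    · exact absurd (foldl_evalStep_top τ) h
    · rw [ih _ h]
      constructor
      · rintro ⟨_, ⟨x, hx, z, hz, rfl⟩, ρ', rfl, rfl, hrun⟩
        refine ⟨x, hx, z.2 :: ρ', by simp, ?_, z.1, ?_, hrun⟩
        · rw [List.map_cons, erase_of_evalAct_has hz]
        · rw [erase_of_evalAct_has hz]; exact hz
      · rintro ⟨x, hx, ρ', rfl, hρ', hrun⟩
        cases ρ' with
        | nil => simp at hρ'
        | cons ψ ρ' =>
          obtain ⟨σ', hψ, hrun⟩ := hrun
          rw [List.map_cons, List.cons.injEq] at hρ'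
          obtain ⟨rfl, rfl⟩ := hρ'
          exact ⟨_, ⟨x, hx, _, hψ, rfl⟩, ρ', by simp, rfl, hrun⟩

theorem safeFrom_of_denot_ne_top {L : Library P M} {σ : S} (h : denot F L Γ σ ≠ .top)
    {τ : List (GAct P M)} (hτ : τ ∈ L.traceSet) : SafeFrom F Γ τ σ := by
  unfold denot at h
  split_ifs at h with hf
  · exact absurd rfl h
  · exact safeFrom_of_foldl_ne_top τ _ (fun e => hf ⟨τ, hτ, e⟩) (σ, []) rfl

/-- Once faults are excluded, folding over sets of configurations amounts to following single paths,
so the rest of the proof can use `Run` and `SafeFrom`. -/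
theorem denot_has_iff {L : Library P M} {σ : S} (h : denot F L Γ σ ≠ .top)
    (ρ : List (Act S P M)) :
    (denot F L Γ σ).Has ρ ↔ ρ.map Act.erase ∈ L.traceSet ∧ Run F Γ ρ σ := by
  unfold denot at h ⊢
  split_ifs at h ⊢ with hf
  · exact absurd rfl h
  · have key : ∀ τ ∈ L.traceSet, (∃ σ', (evalTrace F Γ τ σ).Has (σ', ρ)) ↔
        ρ.map Act.erase = τ ∧ Run F Γ ρ σ := by
      intro τ hτ
      refine (foldl_evalStep_has_iff τ _ (fun e => hf ⟨τ, hτ, e⟩) ρ).trans ?_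
      simp
    constructor
    · rintro ⟨τ, hτ, hσ⟩
      obtain ⟨rfl, hrun⟩ := (key τ hτ).1 hσ
      exact ⟨hτ, hrun⟩
    · rintro ⟨hτ, hrun⟩
      exact ⟨_, hτ, (key _ hτ).2 ⟨rfl, hrun⟩⟩

end Run

/-! ### The shape of the traces of the most general client -/

section Traces

variable {P : Type w} {M : Type v}

/-- The action is a primitive command. -/
def GAct.IsPrim : GAct P M → Prop
  | .prim _ _ => True
  | _ => False

/-- Prefixes of sequences of calls of the methods `ms`, each call followed by primitive commands
and a return; the first argument says whether a call is pending at the start. -/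
def Sequential (ms : List M) : Bool → List (GAct P M) → Prop
  | _, [] => True
  | b, .prim _ _ :: τ => b = true ∧ Sequential ms true τ
  | b, .call _ m :: τ => b = false ∧ m ∈ ms ∧ Sequential ms true τ
  | b, .ret _ m :: τ => b = true ∧ m ∈ ms ∧ Sequential ms false τ

theorem Sequential.of_append_right {ms : List M} {b : Bool} {τ τ' : List (GAct P M)}
    (h : Sequential ms b (τ ++ τ')) : ∃ b', Sequential ms b' τ' := by
  induction τ generalizing b with
  | nil => exact ⟨b, h⟩
  | cons φ τ ih =>
    cases φ with
    | prim t c => exact ih h.2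
    | call t m => exact ih h.2.2
    | ret t m => exact ih h.2.2

theorem Sequential.of_append_left {ms : List M} {b : Bool} {τ τ' : List (GAct P M)}
    (h : Sequential ms b (τ ++ τ')) : Sequential ms b τ := by
  induction τ generalizing b with
  | nil => trivial
  | cons φ τ ih =>
    cases φ with
    | prim t c => exact ⟨h.1, ih h.2⟩
    | call t m => exact ⟨h.1, h.2.1, ih h.2.2⟩
    | ret t m => exact ⟨h.1, h.2.1, ih h.2.2⟩

theorem Sequential.prims_append {ms : List M} {τ τ' : List (GAct P M)}
    (hτ : ∀ φ ∈ τ, φ.IsPrim) (h : Sequential ms true τ') : Sequential ms true (τ ++ τ') := by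
  induction τ with
  | nil => exact h
  | cons φ τ ih =>
    have := hτ φ (by simp)
    cases φ with
    | prim t c => exact ⟨rfl, ih fun φ hφ => hτ φ (by simp [hφ])⟩
    | call t m => exact this.elim
    | ret t m => exact this.elim

theorem Sequential.mem_of_ret_mem {ms : List M} {b : Bool} {τ : List (GAct P M)}
    (h : Sequential ms b τ) {t : ThreadID} {m : M} (hm : GAct.ret t m ∈ τ) : m ∈ ms := by
  obtain ⟨τ₁, τ₂, rfl⟩ := List.append_of_mem hm
  obtain ⟨_, h'⟩ := h.of_append_right
  exact h'.2.1

/-- A primitive command runs only inside a pending call, and a pending call must return before the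
next one starts. This is what lets a call move to the front without passing an action of its own
thread. -/
theorem Sequential.eq_nil_of_prims_append_call {ms : List M} {b : Bool} {τ τ' : List (GAct P M)}
    {t : ThreadID} {m : M} (hτ : ∀ φ ∈ τ, φ.IsPrim)
    (h : Sequential ms b (τ ++ GAct.call t m :: τ')) : τ = [] := by
  suffices hs : ∀ τ : List (GAct P M), (∀ φ ∈ τ, φ.IsPrim) →
      ¬ Sequential ms true (τ ++ GAct.call t m :: τ') by
    cases τ with
    | nil => rfl
    | cons φ τ =>
      have := hτ φ (by simp)
      cases φ with
      | prim t c => exact (hs τ (fun φ hφ => hτ φ (by simp [hφ])) h.2).elim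
      | call t m => exact this.elim
      | ret t m => exact this.elim
  intro τ hτ
  induction τ with
  | nil => exact fun h => by cases h.1
  | cons φ τ ih =>
    have := hτ φ (by simp)
    cases φ with
    | prim t c => exact fun h => ih (fun φ hφ => hτ φ (by simp [hφ])) h.2
    | call t m => exact this.elim
    | ret t m => exact this.elim

theorem Comm.CallFree.isPrim_of_mem {t : ThreadID} {η : M → ThreadID → Language (GAct P M)}
    {C : Comm P M} (hC : C.CallFree) {τ : List (GAct P M)} (hτ : τ ∈ C.traces t η) :
    ∀ φ ∈ τ, φ.IsPrim := by
  induction C generalizing τ with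
  | prim c =>
    obtain rfl : τ = [GAct.prim t c] := hτ
    simp [GAct.IsPrim]
  | call m => exact hC.elim
  | seq C₁ C₂ ih₁ ih₂ =>
    obtain ⟨τ₁, h₁, τ₂, h₂, rfl⟩ := Language.mem_mul.1 hτ
    intro φ hφ
    rcases List.mem_append.1 hφ with h | h
    · exact ih₁ hC.1 h₁ φ h
    · exact ih₂ hC.2 h₂ φ h
  | choice C₁ C₂ ih₁ ih₂ =>
    rcases (Language.mem_add _ _ _).1 hτ with h | h
    · exact ih₁ hC.1 h
    · exact ih₂ hC.2 h
  | star C ih =>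
    obtain ⟨l, rfl, hl⟩ := Language.mem_kstar.1 hτ
    intro φ hφ
    obtain ⟨τ, hτ, hφ⟩ := List.mem_flatten.1 hφ
    exact ih hC (hl τ hτ) φ hφ

theorem Comm.exists_of_mem_traces_sumCalls {t : ThreadID}
    {η : M → ThreadID → Language (GAct P M)} {ms : List M} (hms : ms ≠ [])
    {τ : List (GAct P M)} (hτ : τ ∈ (Comm.sumCalls ms hms).traces t η) :
    ∃ m ∈ ms, ∃ τ₀ ∈ η m t, τ = [GAct.call t m] ++ τ₀ ++ [GAct.ret t m] := by
  induction ms with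
  | nil => exact absurd rfl hms
  | cons m ms ih =>
    cases ms with
    | nil => exact ⟨m, by simp, hτ⟩
    | cons m' ms =>
      rcases (Language.mem_add _ _ _).1 hτ with h | h
      · exact ⟨m, by simp, h⟩
      · obtain ⟨m₁, hm₁, h⟩ := ih (List.cons_ne_nil _ _) h
        exact ⟨m₁, List.mem_cons_of_mem _ hm₁, h⟩

theorem Library.sequential_of_mem_traces_mgc (L : Library P M) {t : ThreadID}
    {τ : List (GAct P M)} (hτ : τ ∈ L.mgc.traces t L.bodyTraces) :
    Sequential L.methods false τ := by
  obtain ⟨l, rfl, hl⟩ := Language.mem_kstar.1 hτ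
  clear hτ
  induction l with
  | nil => trivial
  | cons τ l ih =>
    obtain ⟨m, hm, τ₀, h₀, rfl⟩ := Comm.exists_of_mem_traces_sumCalls _ (hl τ (by simp))
    have hp := (L.body_callFree m hm).isPrim_of_mem h₀
    simp only [List.flatten_cons, List.append_assoc, List.cons_append,
      List.nil_append]
    exact ⟨rfl, hm, .prims_append hp ⟨rfl, hm, ih fun y hy => hl y (by simp [hy])⟩⟩

/-- The actions of thread `t`. -/
def threadProj (t : ThreadID) (τ : List (GAct P M)) : List (GAct P M) :=
  τ.filter fun φ => decide (φ.tid = t)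

theorem threadProj_append (t : ThreadID) (τ τ' : List (GAct P M)) :
    threadProj t (τ ++ τ') = threadProj t τ ++ threadProj t τ' := List.filter_append ..

theorem Library.sequential_threadProj (L : Library P M) {τ : List (GAct P M)}
    (hτ : τ ∈ L.traceSet) (t : ThreadID) : ∃ b, Sequential L.methods b (threadProj t τ) := by
  obtain ⟨_, h, τ', rfl⟩ := hτ
  simp only [Set.mem_iUnion] at h
  obtain ⟨k, _, hk, h⟩ := h
  by_cases ht : (t : ℕ) ≤ k
  · have := L.sequential_of_mem_traces_mgc (h t ht)
    rw [List.filter_append] at this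
    exact ⟨false, this.of_append_left⟩
  · refine ⟨false, ?_⟩
    have : threadProj t τ = [] := by
      refine List.filter_eq_nil_iff.2 fun φ hφ e => ht ?_
      rw [← of_decide_eq_true e]
      exact hk φ (by simp [hφ])
    rw [this]
    trivial

theorem Library.mem_methods_of_ret_mem (L : Library P M) {τ : List (GAct P M)}
    (hτ : τ ∈ L.traceSet) {t : ThreadID} {m : M} (h : GAct.ret t m ∈ τ) : m ∈ L.methods := by
  obtain ⟨b, hb⟩ := L.sequential_threadProj hτ t
  exact hb.mem_of_ret_mem (t := t) (List.mem_filter.2 ⟨h, decide_eq_true rfl⟩)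

theorem mem_iff_of_threadProj_eq {τ τ' : List (GAct P M)}
    (h : ∀ t, threadProj t τ = threadProj t τ') (φ : GAct P M) : φ ∈ τ ↔ φ ∈ τ' := by
  have key : ∀ τ : List (GAct P M), φ ∈ τ ↔ φ ∈ threadProj φ.tid τ := fun τ => by
    simp [threadProj]
  rw [key τ, key τ', h]

theorem Library.mem_traceSet_of_threadProj_eq (L : Library P M) {τ τ' : List (GAct P M)}
    (h : ∀ t, threadProj t τ = threadProj t τ') (hτ : τ ∈ L.traceSet) : τ' ∈ L.traceSet := by
  obtain ⟨_, hp, τ'', rfl⟩ := hτ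
  -- `parallel` depends only on thread projections, so the same suffix completes both prefixes.
  refine ⟨τ' ++ τ'', ?_, τ'', rfl⟩
  simp only [Set.mem_iUnion] at hp ⊢
  obtain ⟨k, hk₁, hk, hp⟩ := hp
  refine ⟨k, hk₁, fun φ hφ => hk φ ?_, fun t ht => ?_⟩
  · rw [List.mem_append] at hφ ⊢
    rwa [mem_iff_of_threadProj_eq h]
  · have := hp t ht
    rw [List.filter_append] at this ⊢
    have e := h t
    unfold threadProj at e
    rwa [← e]

end Traces

/-! ### Linearization with explicit positions -/

section Lin

variable {S : Type u} {M : Type v}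

/-- The order of the two interface actions has to be preserved. -/
def MustPrecede (ψ ψ' : IAct S M) : Prop :=
  ψ.tid = ψ'.tid ∨ (ψ.IsRet ∧ ψ'.IsCall)

/-- A history `H` with increasing positions and a rearrangement `H'` of it that linearizes it. -/
structure KeyedLin (H H' : List (ℕ × IAct S M)) : Prop where
  sorted : H.Pairwise fun x y => x.1 < y.1
  perm : H.Perm H'
  order : H'.Pairwise fun x y => y.1 < x.1 → ¬ MustPrecede y.2 x.2

theorem perm_ofFn_comp {α : Type*} {n m : ℕ} (e : Fin m ≃ Fin n) (f : Fin n → α) :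
    (List.ofFn (f ∘ e)).Perm (List.ofFn f) := by
  obtain rfl : m = n := by simpa using Fintype.card_congr e
  exact Equiv.Perm.ofFn_comp_perm e f

theorem HistLin.exists_keyedLin {H H' : List (IAct S M)} (h : HistLin H H') :
    ∃ K K', KeyedLin K K' ∧ K.map Prod.snd = H ∧ K'.map Prod.snd = H' := by
  obtain ⟨ρ, hρ⟩ := h
  -- The keys are positions in `H`; they tell repeated actions apart, so that the bijection becomes
  -- a permutation of lists, suited to induction.
  refine ⟨List.ofFn fun i => (i.val, H.get i),
    List.ofFn ((fun i => (i.val, H.get i)) ∘ ρ.symm), ⟨?_, (perm_ofFn_comp _ _).symm, ?_⟩, ?_, ?_⟩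
  · rw [List.pairwise_ofFn]
    exact fun i j hij => hij
  · rw [List.pairwise_ofFn]
    intro i j hij hlt hp
    have := (hρ (ρ.symm j) (ρ.symm i)).2 ⟨hlt, hp⟩
    simp only [Equiv.apply_symm_apply] at this
    exact absurd this hij.asymm
  · rw [List.map_ofFn]
    exact List.ofFn_get H
  · rw [List.map_ofFn]
    refine Eq.trans ?_ (List.ofFn_get H')
    congr 1
    funext j
    simpa using (hρ (ρ.symm j) (ρ.symm j)).1

/-- The head of `H` has the least key, so whatever stands before it in `H'` forms an inversion with
it. -/
theorem KeyedLin.exists_of_cons {x : ℕ × IAct S M} {H H' : List (ℕ × IAct S M)}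
    (h : KeyedLin (x :: H) H') : ∃ A B, H' = A ++ x :: B ∧ KeyedLin H (A ++ B) ∧
      ∀ y ∈ A, ¬ MustPrecede x.2 y.2 := by
  obtain ⟨A, B, rfl⟩ := List.append_of_mem (h.perm.subset (List.mem_cons_self ..))
  have hp : H.Perm (A ++ B) := (h.perm.trans List.perm_middle).cons_inv
  have hs := List.pairwise_cons.1 h.sorted
  refine ⟨A, B, rfl, ⟨hs.2, hp, h.order.sublist ?_⟩, fun y hy => ?_⟩
  · exact (List.Sublist.refl A).append (List.sublist_cons_self x B)
  · exact (List.pairwise_append.1 h.order).2.2 y hy x (by simp)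
      (hs.1 y (hp.symm.subset (by simp [hy])))

theorem HistLin.refl (H : List (IAct S M)) : HistLin H H :=
  ⟨Equiv.refl _, fun _ _ => ⟨rfl, fun h => h.1⟩⟩

end Lin

/-! ### Execution on states split into pieces -/

section Pieces

variable {S : Type u} [SepAlgebra S] {P : Type w} {M : Type v}

/-- Execution of an annotated trace on a multiset of pieces of a state. Primitive commands act on
a single piece, calls add a piece and returns remove one, and no step requires the pieces to be
compatible. -/
inductive PieceRun (F : PrimSem S P) (Γ : MethodSpec S M) :
    Multiset S → List (Act S P M) → Prop
  | nil (X : Multiset S) : PieceRun F Γ X []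
  | comb {a b c : S} {X : Multiset S} {ρ : List (Act S P M)} (h : op a b = some c)
      (hr : PieceRun F Γ (c ::ₘ X) ρ) : PieceRun F Γ (a ::ₘ b ::ₘ X) ρ
  | split {a b c : S} {X : Multiset S} {ρ : List (Act S P M)} (h : op a b = some c)
      (hr : PieceRun F Γ (a ::ₘ b ::ₘ X) ρ) : PieceRun F Γ (c ::ₘ X) ρ
  | prim {a a' : S} {t : ThreadID} {c : P} {X : Multiset S} {ρ : List (Act S P M)}
      (h : (F.f c t a).Has a') (hr : PieceRun F Γ (a' ::ₘ X) ρ) :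
      PieceRun F Γ (a ::ₘ X) (.prim t c :: ρ)
  | call {g : S} {t : ThreadID} {m : M} {X : Multiset S} {ρ : List (Act S P M)}
      (h : g ∈ Γ.pre m t) (hr : PieceRun F Γ (g ::ₘ X) ρ) :
      PieceRun F Γ X (.iface (.call t m g) :: ρ)
  | ret {g : S} {t : ThreadID} {m : M} {X : Multiset S} {ρ : List (Act S P M)}
      (h : g ∈ Γ.post m t) (hr : PieceRun F Γ X ρ) :
      PieceRun F Γ (g ::ₘ X) (.iface (.ret t m g) :: ρ)

variable {F : PrimSem S P} {Γ : MethodSpec S M}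

theorem Run.pieceRun {ρ : List (Act S P M)} {σ : S} (h : Run F Γ ρ σ) :
    PieceRun F Γ {σ} ρ := by
  induction ρ generalizing σ with
  | nil => exact .nil _
  | cons φ ρ ih =>
    obtain ⟨σ', hφ, hr⟩ := h
    rcases φ with ⟨t, c⟩ | ⟨t, m, g⟩ | ⟨t, m, g⟩
    · exact .prim (X := 0) (evalAct_prim_has.1 hφ).1 (ih hr)
    · obtain ⟨g', hg, e, h'⟩ := evalAct_call_has.1 hφ
      cases h'
      exact .call hg (.comb (X := 0) ((SepAlgebra.op_comm _ _).trans e) (ih hr))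
    · obtain ⟨g', hg, _, e, h'⟩ := evalAct_ret_has.1 hφ
      cases h'
      exact .split (X := 0) e (.ret hg (ih hr))

/-- Regrouping steps may precede the first action, so the pieces left after it are not known in
advance; the tail must be replaceable for every `X`. -/
theorem PieceRun.exists_cons {X : Multiset S} {φ : Act S P M} {ρ : List (Act S P M)}
    {Q : List (Act S P M) → Prop} (h : PieceRun F Γ X (φ :: ρ))
    (hρ : ∀ X, PieceRun F Γ X ρ → ∃ ρ', Q ρ' ∧ PieceRun F Γ X ρ') :
    ∃ ρ', Q ρ' ∧ PieceRun F Γ X (φ :: ρ') := by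
  generalize hl : φ :: ρ = l at h
  induction h with
  | nil => cases hl
  | comb h _ ih => exact (ih hl).imp fun _ hq => ⟨hq.1, .comb h hq.2⟩
  | split h _ ih => exact (ih hl).imp fun _ hq => ⟨hq.1, .split h hq.2⟩
  | prim h hr => cases hl; exact (hρ _ hr).imp fun _ hq => ⟨hq.1, .prim h hq.2⟩
  | call h hr => cases hl; exact (hρ _ hr).imp fun _ hq => ⟨hq.1, .call h hq.2⟩
  | ret h hr => cases hl; exact (hρ _ hr).imp fun _ hq => ⟨hq.1, .ret h hq.2⟩

theorem PieceRun.exists_append {X : Multiset S} {ρ₀ ρ : List (Act S P M)}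
    {Q : List (Act S P M) → Prop} (h : PieceRun F Γ X (ρ₀ ++ ρ))
    (hρ : ∀ X, PieceRun F Γ X ρ → ∃ ρ', Q ρ' ∧ PieceRun F Γ X ρ') :
    ∃ ρ', Q ρ' ∧ PieceRun F Γ X (ρ₀ ++ ρ') := by
  induction ρ₀ generalizing X with
  | nil => exact hρ X h
  | cons φ ρ₀ ih =>
    obtain ⟨_, ⟨ρ', hq, rfl⟩, hr⟩ := h.exists_cons (Q := fun l => ∃ ρ', Q ρ' ∧ l = ρ₀ ++ ρ')
      fun X hX => by
        obtain ⟨ρ', hq, hr⟩ := ih hX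
        exact ⟨_, ⟨ρ', hq, rfl⟩, hr⟩
    exact ⟨ρ', hq, hr⟩

theorem PieceRun.cons_mono {X : Multiset S} {φ : Act S P M} {ρ ρ' : List (Act S P M)}
    (h : PieceRun F Γ X (φ :: ρ)) (hρ : ∀ X, PieceRun F Γ X ρ → PieceRun F Γ X ρ') :
    PieceRun F Γ X (φ :: ρ') := by
  obtain ⟨_, rfl, hr⟩ := h.exists_cons (Q := (· = ρ')) fun X hX => ⟨ρ', rfl, hρ X hX⟩
  exact hr

/-- A piece handed over by a call can be present from the start: until the call it lies idle, and no
step of `PieceRun` asks it to be compatible with the others. -/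
theorem PieceRun.remove_call {X : Multiset S} {t : ThreadID} {m : M} {g : S}
    {ρ ρ' : List (Act S P M)} (h : PieceRun F Γ X (ρ ++ .iface (.call t m g) :: ρ')) :
    g ∈ Γ.pre m t ∧ PieceRun F Γ (g ::ₘ X) (ρ ++ ρ') := by
  generalize hl : ρ ++ .iface (.call t m g) :: ρ' = l at h
  induction h generalizing ρ with
  | nil => simp at hl
  | comb h _ ih =>
    refine ⟨(ih hl).1, ?_⟩
    rw [Multiset.cons_swap, Multiset.cons_swap g]
    refine .comb h ?_
    rw [Multiset.cons_swap]
    exact (ih hl).2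
  | split h _ ih =>
    refine ⟨(ih hl).1, ?_⟩
    rw [Multiset.cons_swap]
    refine .split h ?_
    rw [Multiset.cons_swap _ g, Multiset.cons_swap _ g]
    exact (ih hl).2
  | prim h hr ih =>
    cases ρ with
    | nil => cases hl
    | cons φ ρ =>
      cases hl
      refine ⟨(ih rfl).1, ?_⟩
      rw [Multiset.cons_swap]
      refine .prim h ?_
      rw [Multiset.cons_swap]
      exact (ih rfl).2
  | call h hr ih =>
    cases ρ with
    | nil => cases hl; exact ⟨h, hr⟩
    | cons φ ρ =>
      cases hl
      refine ⟨(ih rfl).1, .call h ?_⟩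
      rw [Multiset.cons_swap]
      exact (ih rfl).2
  | ret h hr ih =>
    cases ρ with
    | nil => cases hl
    | cons φ ρ =>
      cases hl
      refine ⟨(ih rfl).1, ?_⟩
      rw [Multiset.cons_swap]
      exact .ret h (ih rfl).2

/-- Dual to `PieceRun.remove_call`: an idle piece can be carried along until a later return removes
it. -/
theorem PieceRun.insert_ret {X : Multiset S} {t : ThreadID} {m : M} {g : S}
    (hg : g ∈ Γ.post m t) {ρ ρ' : List (Act S P M)} (h : PieceRun F Γ X (ρ ++ ρ')) :
    PieceRun F Γ (g ::ₘ X) (ρ ++ .iface (.ret t m g) :: ρ') := by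
  induction ρ generalizing X with
  | nil => exact .ret hg h
  | cons φ ρ ih =>
    rw [List.cons_append] at h ⊢
    -- The inner induction passes through the regrouping steps that precede `φ`.
    generalize hl : φ :: (ρ ++ ρ') = l at h
    induction h with
    | nil => cases hl
    | comb h _ ih' =>
      rw [Multiset.cons_swap, Multiset.cons_swap g]
      refine .comb h ?_
      rw [Multiset.cons_swap]
      exact ih' hl
    | split h _ ih' =>
      rw [Multiset.cons_swap]
      refine .split h ?_
      rw [Multiset.cons_swap _ g, Multiset.cons_swap _ g]
      exact ih' hl
    | prim h hr =>
      cases hl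
      rw [Multiset.cons_swap]
      refine .prim h ?_
      rw [Multiset.cons_swap]
      exact ih hr
    | call h hr =>
      cases hl
      refine .call h ?_
      rw [Multiset.cons_swap]
      exact ih hr
    | ret h hr =>
      cases hl
      rw [Multiset.cons_swap]
      exact .ret h (ih hr)

theorem PieceRun.delay_ret {X : Multiset S} {t : ThreadID} {m : M} {g : S}
    {ρ ρ' : List (Act S P M)} (h : PieceRun F Γ X (.iface (.ret t m g) :: (ρ ++ ρ'))) :
    PieceRun F Γ X (ρ ++ .iface (.ret t m g) :: ρ') := by
  generalize hl : Act.iface (.ret t m g) :: (ρ ++ ρ') = l at h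
  induction h with
  | nil => cases hl
  | comb h _ ih => exact .comb h (ih hl)
  | split h _ ih => exact .split h (ih hl)
  | prim => cases hl
  | call => cases hl
  | ret h hr => cases hl; exact hr.insert_ret h

end Pieces

/-! ### Rearranging a trace to match a linearized history -/

section Rearrange

variable {S : Type u} {P : Type w} {M : Type v}

/-- The primitive commands of a trace. -/
def prims (ρ : List (Act S P M)) : List (Act S P M) :=
  ρ.filter fun φ => match φ with
    | .prim _ _ => true
    | .iface _ => false

/-- The calls and returns of a trace, as actions. -/
def ifaces (ρ : List (Act S P M)) : List (Act S P M) := (history ρ).map Act.iface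

theorem history_append (ρ ρ' : List (Act S P M)) :
    history (ρ ++ ρ') = history ρ ++ history ρ' := List.filterMap_append

theorem history_cons_iface (ψ : IAct S M) (ρ : List (Act S P M)) :
    history (.iface ψ :: ρ) = ψ :: history ρ := rfl

theorem history_prims (ρ : List (Act S P M)) : history (prims ρ) = [] := by
  induction ρ with
  | nil => rfl
  | cons φ ρ ih => cases φ <;> exact ih

theorem history_ifaces (ρ : List (Act S P M)) : history (ifaces ρ) = history ρ := by
  induction ρ with
  | nil => rfl
  | cons φ ρ ih =>
    cases φ with
    | prim => exact ih
    | iface ψ => exact congrArg (ψ :: ·) ih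

theorem exists_of_history_eq_append_cons {ρ : List (Act S P M)} {A B : List (IAct S M)}
    {ψ : IAct S M} (h : history ρ = A ++ ψ :: B) :
    ∃ ρ₁ ρ₂, ρ = ρ₁ ++ .iface ψ :: ρ₂ ∧ history ρ₁ = A ∧ history ρ₂ = B := by
  induction ρ generalizing A with
  | nil => simp [history] at h
  | cons φ ρ ih =>
    cases φ with
    | prim t c =>
      obtain ⟨ρ₁, ρ₂, rfl, h₁, h₂⟩ := ih h
      exact ⟨.prim t c :: ρ₁, ρ₂, rfl, h₁, h₂⟩
    | iface ψ' =>
      rw [history_cons_iface] at h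
      cases A with
      | nil => cases h; exact ⟨[], ρ, rfl, rfl, rfl⟩
      | cons a A =>
        rw [List.cons_append, List.cons.injEq] at h
        obtain ⟨ρ₁, ρ₂, rfl, h₁, h₂⟩ := ih h.2
        exact ⟨.iface ψ' :: ρ₁, ρ₂, rfl, by rw [history_cons_iface, h₁, h.1], h₂⟩

/-- The actions of thread `t` in an annotated trace, without annotations. -/
def actProj (t : ThreadID) (ρ : List (Act S P M)) : List (GAct P M) :=
  threadProj t (ρ.map Act.erase)

theorem actProj_append (t : ThreadID) (ρ ρ' : List (Act S P M)) :
    actProj t (ρ ++ ρ') = actProj t ρ ++ actProj t ρ' := by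
  unfold actProj
  rw [List.map_append, threadProj_append]

theorem actProj_cons (t : ThreadID) (φ : Act S P M) (ρ : List (Act S P M)) :
    actProj t (φ :: ρ) = actProj t [φ] ++ actProj t ρ := actProj_append t [φ] ρ

theorem Act.tid_erase_iface (ψ : IAct S M) :
    (Act.iface ψ : Act S P M).erase.tid = ψ.tid := by cases ψ <;> rfl

theorem actProj_singleton_of_eq {t : ThreadID} {φ : Act S P M} (h : φ.erase.tid = t) :
    actProj t [φ] = [φ.erase] := by
  simp [actProj, threadProj, h]

theorem actProj_singleton_of_ne {t : ThreadID} {φ : Act S P M} (h : φ.erase.tid ≠ t) :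
    actProj t [φ] = [] := by
  simp [actProj, threadProj, h]

theorem isPrim_of_mem_actProj {t : ThreadID} {ρ : List (Act S P M)}
    (h : ∀ ψ ∈ history ρ, ψ.tid ≠ t) : ∀ φ ∈ actProj t ρ, φ.IsPrim := by
  intro φ hφ
  simp only [actProj, threadProj, List.mem_filter, List.mem_map, decide_eq_true_eq] at hφ
  obtain ⟨⟨a, ha, rfl⟩, ht⟩ := hφ
  cases a with
  | prim t c => trivial
  | iface ψ =>
    refine absurd ((Act.tid_erase_iface ψ).symm.trans ht) (h ψ ?_)
    exact List.mem_filterMap.2 ⟨_, ha, rfl⟩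

theorem actProj_ifaces_eq_nil {t : ThreadID} {ρ : List (Act S P M)}
    (h : ∀ ψ ∈ history ρ, ψ.tid ≠ t) : actProj t (ifaces ρ) = [] := by
  refine List.filter_eq_nil_iff.2 fun φ hφ e => ?_
  simp only [ifaces, List.mem_map] at hφ
  obtain ⟨_, ⟨ψ, hψ, rfl⟩, rfl⟩ := hφ
  exact h ψ hψ ((Act.tid_erase_iface ψ).symm.trans (of_decide_eq_true e))

theorem actProj_eq_nil_of_sequential_false {ms : List M} {t : ThreadID}
    {ρ : List (Act S P M)} (hc : ∀ ψ ∈ history ρ, ¬ ψ.IsCall)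
    (h : Sequential ms false (actProj t ρ)) :
    actProj t (prims ρ) = [] ∧ actProj t (ifaces ρ) = [] ∧ actProj t ρ = [] := by
  induction ρ with
  | nil => exact ⟨rfl, rfl, rfl⟩
  | cons φ ρ ih =>
    by_cases ht : φ.erase.tid = t
    · rw [actProj_cons, actProj_singleton_of_eq ht] at h
      rcases φ with ⟨t, c⟩ | ⟨t, m, g⟩ | ⟨t, m, g⟩
      · exact absurd h.1 (by simp)
      · exact (hc (.call t m g) (by simp [history_cons_iface]) trivial).elim
      · exact absurd h.1 (by simp)
    · rw [actProj_cons, actProj_singleton_of_ne ht] at h ⊢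
      cases φ with
      | prim t c =>
        obtain ⟨h₁, h₂, h₃⟩ := ih hc h
        refine ⟨?_, h₂, h₃⟩
        change actProj _ (_ :: prims ρ) = []
        rw [actProj_cons, actProj_singleton_of_ne ht, h₁]; rfl
      | iface ψ =>
        obtain ⟨h₁, h₂, h₃⟩ := ih (fun ψ hψ => hc ψ (List.mem_cons_of_mem _ hψ)) h
        refine ⟨h₁, ?_, h₃⟩
        change actProj _ (_ :: ifaces ρ) = []
        rw [actProj_cons, actProj_singleton_of_ne ht, h₂]; rfl

/-- Without calls, a thread can only finish its pending method: primitive commands, then at most one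
return, then nothing. Postponing all returns is thus invisible to each thread. -/
theorem actProj_eq_prims_append_ifaces {ms : List M} {b : Bool} {t : ThreadID}
    {ρ : List (Act S P M)} (hc : ∀ ψ ∈ history ρ, ¬ ψ.IsCall)
    (h : Sequential ms b (actProj t ρ)) :
    actProj t ρ = actProj t (prims ρ) ++ actProj t (ifaces ρ) := by
  induction ρ generalizing b with
  | nil => rfl
  | cons φ ρ ih =>
    rw [actProj_cons] at h
    rw [actProj_cons t φ ρ]
    cases φ with
    | prim t' c =>
      obtain ⟨_, h'⟩ := h.of_append_right
      change _ = actProj _ (_ :: prims ρ) ++ actProj _ (ifaces ρ)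
      rw [actProj_cons t _ (prims ρ), List.append_assoc, ← ih hc h']
    | iface ψ =>
      have hc' : ∀ ψ ∈ history ρ, ¬ ψ.IsCall := fun ψ hψ => hc ψ (List.mem_cons_of_mem _ hψ)
      change _ = actProj _ (prims ρ) ++ actProj _ (_ :: ifaces ρ)
      rw [actProj_cons t _ (ifaces ρ)]
      by_cases ht : (Act.iface ψ : Act S P M).erase.tid = t
      · rw [actProj_singleton_of_eq ht] at h ⊢
        cases ψ with
        | call t m g => exact (hc (.call t m g) (by simp [history_cons_iface]) trivial).elim
        | ret t m g =>
          obtain ⟨h₁, h₂, h₃⟩ := actProj_eq_nil_of_sequential_false hc' h.2.2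
          rw [h₁, h₂, h₃]; rfl
      · rw [actProj_singleton_of_ne ht] at h ⊢
        exact ih hc' h

variable [SepAlgebra S] {F : PrimSem S P} {Γ : MethodSpec S M}

theorem PieceRun.delay_rets {X : Multiset S} {ρ ρ₁ ρ₂ : List (Act S P M)}
    (hc : ∀ ψ ∈ history ρ, ¬ ψ.IsCall) (h : PieceRun F Γ X (ρ ++ (ρ₁ ++ ρ₂))) :
    PieceRun F Γ X ((prims ρ ++ ρ₁) ++ (ifaces ρ ++ ρ₂)) := by
  induction ρ generalizing X with
  | nil => exact h
  | cons φ ρ ih =>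
    rcases φ with ⟨t, c⟩ | ⟨t, m, g⟩ | ⟨t, m, g⟩
    · exact h.cons_mono fun _ => ih hc
    · exact (hc (.call t m g) (by simp [history_cons_iface]) trivial).elim
    · exact (h.cons_mono fun _ => ih fun ψ hψ => hc ψ (List.mem_cons_of_mem _ hψ)).delay_ret

/-- Selection sort along `K`. A call that comes next in `K` is pulled to the front. A return cannot
be, since earlier primitive commands may produce the piece it removes; instead the returns before it
are pushed behind it. No call stands before it, as a return must precede later calls. -/
theorem PieceRun.exists_rearrangement {ms : List M} {K K' : List (ℕ × IAct S M)}
    (hK : KeyedLin K K') {ρ : List (Act S P M)} (hρ : history ρ = K'.map Prod.snd)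
    (hseq : ∀ t, ∃ b, Sequential ms b (actProj t ρ)) {X : Multiset S}
    (hrun : PieceRun F Γ X ρ) :
    ∃ ρ', history ρ' = K.map Prod.snd ∧ (∀ t, actProj t ρ' = actProj t ρ) ∧
      PieceRun F Γ X ρ' := by
  induction K generalizing K' ρ X with
  | nil =>
    refine ⟨ρ, ?_, fun _ => rfl, hrun⟩
    rw [hρ, List.nil_perm.1 hK.perm]
  | cons x K ih =>
    obtain ⟨A, B, rfl, hK', hA⟩ := hK.exists_of_cons
    rw [List.map_append, List.map_cons] at hρ
    obtain ⟨ρ₁, ρ₂, rfl, h₁, h₂⟩ := exists_of_history_eq_append_cons hρ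
    obtain ⟨i, ψ⟩ := x
    dsimp only at hA hseq hrun ⊢
    have htid : ∀ ψ' ∈ history ρ₁, ψ'.tid ≠ ψ.tid := by
      intro ψ' hψ' e
      rw [h₁] at hψ'
      obtain ⟨y, hy, rfl⟩ := List.mem_map.1 hψ'
      exact hA y hy (.inl e.symm)
    cases ψ with
    | call t m g =>
      have hproj : ∀ t', actProj t' (.iface (.call t m g) :: (ρ₁ ++ ρ₂)) =
          actProj t' (ρ₁ ++ .iface (.call t m g) :: ρ₂) := by
        intro t'
        rw [actProj_cons, actProj_append, actProj_append, actProj_cons t' _ ρ₂]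
        by_cases ht : t = t'
        · subst ht
          obtain ⟨b, hb⟩ := hseq t
          rw [actProj_append, actProj_cons t _ ρ₂,
            actProj_singleton_of_eq (t := t) (φ := Act.iface (.call t m g)) rfl] at hb
          have := hb.eq_nil_of_prims_append_call (isPrim_of_mem_actProj (t := t) htid)
          rw [this]; rfl
        · rw [actProj_singleton_of_ne (φ := Act.iface (.call t m g)) ht]; rfl
      obtain ⟨hg, hrun'⟩ := hrun.remove_call
      obtain ⟨ρ', e₁, e₂, hr⟩ := ih hK' (ρ := ρ₁ ++ ρ₂)
        (by rw [history_append, h₁, h₂, List.map_append])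
        (fun t' => by
          obtain ⟨b, hb⟩ := hseq t'
          rw [← hproj, actProj_cons] at hb
          exact hb.of_append_right) hrun'
      refine ⟨.iface (.call t m g) :: ρ', ?_, fun t' => ?_, .call hg hr⟩
      · rw [history_cons_iface, e₁, List.map_cons]
      · rw [← hproj, actProj_cons, e₂, ← actProj_cons]
    | ret t m g =>
      have hc : ∀ ψ' ∈ history ρ₁, ¬ ψ'.IsCall := by
        intro ψ' hψ' e
        rw [h₁] at hψ'
        obtain ⟨y, hy, rfl⟩ := List.mem_map.1 hψ'
        exact hA y hy (.inr ⟨trivial, e⟩)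
      have hproj : ∀ t', actProj t' ((prims ρ₁ ++ [.iface (.ret t m g)]) ++ (ifaces ρ₁ ++ ρ₂)) =
          actProj t' (ρ₁ ++ .iface (.ret t m g) :: ρ₂) := by
        intro t'
        obtain ⟨b, hb⟩ := hseq t'
        rw [actProj_append] at hb
        rw [actProj_append, actProj_append, actProj_append, actProj_append, actProj_cons t' _ ρ₂,
          actProj_eq_prims_append_ifaces hc hb.of_append_left]
        by_cases ht : t = t'
        · subst ht
          rw [actProj_ifaces_eq_nil (t := t) htid]
          simp
        · rw [actProj_singleton_of_ne (φ := Act.iface (.ret t m g)) ht]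
          simp
      have hrun' := PieceRun.delay_rets (ρ₁ := [.iface (.ret t m g)]) hc hrun
      obtain ⟨ρ', e₁, e₂, hr⟩ : ∃ ρ', history ρ' = K.map Prod.snd ∧
          (∀ t', actProj t' ρ' = actProj t' (ifaces ρ₁ ++ ρ₂)) ∧
          PieceRun F Γ X ((prims ρ₁ ++ [.iface (.ret t m g)]) ++ ρ') := by
        -- The two conditions on `ρ'` are grouped into the single predicate that
        -- `PieceRun.exists_append` carries.
        simp only [← and_assoc]
        refine hrun'.exists_append fun X hX => ?_
        simp only [and_assoc]
        refine ih hK' ?_ (fun t' => ?_) hX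
        · rw [history_append, history_ifaces, h₁, h₂, List.map_append]
        · obtain ⟨b, hb⟩ := hseq t'
          rw [← hproj, actProj_append] at hb
          exact hb.of_append_right
      refine ⟨_, ?_, fun t' => ?_, hr⟩
      · rw [history_append, history_append, history_prims, e₁]; rfl
      · rw [actProj_append, e₂, ← actProj_append, hproj]

end Rearrange

/-! ### Interface actions split into required and extra state -/

/-- A call or a return that transfers the state `s`, split into a part `g` and an extra
part `a`. -/
inductive SplitAct (S : Type u) (M : Type v) where
  | call (t : ThreadID) (m : M) (g a s : S)
  | ret (t : ThreadID) (m : M) (g a s : S)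

namespace SplitAct

variable {S : Type u} {M : Type v}

/-- The action on the whole state. -/
def full : SplitAct S M → IAct S M
  | call t m _ _ s => .call t m s
  | ret t m _ _ s => .ret t m s

/-- The action on the part without the extra state. -/
def base : SplitAct S M → IAct S M
  | call t m g _ _ => .call t m g
  | ret t m g _ _ => .ret t m g

end SplitAct

/-! ### Removing the extra state from a run of `L₁` and adding it to a run of `L₂` -/

section Frame

variable {S : Type u} [SepAlgebra S] {P : Type w} {M : Type v}

/-- The history can be evaluated from a state `θ * E` for the specification `Γ'`, such that the
first parts of the transferred states are added to and removed from `θ` (up to footprints), and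
the extra parts are added to and removed from `E`. -/
def SplitEval (Γ' : MethodSpec S M) : List (SplitAct S M) → S → S → Prop
  | [], _, _ => True
  | .call t m g a s :: W, θ, E => ∃ θ₀ θ' E', footprint θ = footprint θ₀ ∧ op θ₀ g = some θ' ∧
      op E a = some E' ∧ Compatible θ' E' ∧ op g a = some s ∧ s ∈ Γ'.pre m t ∧
      SplitEval Γ' W θ' E'
  | .ret t m g a s :: W, θ, E => ∃ θ₀ θ' E', footprint θ = footprint θ₀ ∧ op g θ' = some θ₀ ∧
      op E' a = some E ∧ op g a = some s ∧ s ∈ Γ'.post m t ∧ SplitEval Γ' W θ' E'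

/-- This absorbs primitive commands, which change `θ` but not its footprint, so `SplitEval` needs
only the calls and returns. -/
theorem SplitEval.of_footprint_eq {Γ' : MethodSpec S M} {W : List (SplitAct S M)} {θ₁ θ₂ E : S}
    (h : SplitEval Γ' W θ₁ E) (hf : footprint θ₂ = footprint θ₁) : SplitEval Γ' W θ₂ E := by
  cases W with
  | nil => trivial
  | cons w W =>
    cases w with
    | call =>
      obtain ⟨θ₀, θ', E', h₁, h⟩ := h
      exact ⟨θ₀, θ', E', hf.trans h₁, h⟩
    | ret =>
      obtain ⟨θ₀, θ', E', h₁, h⟩ := h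
      exact ⟨θ₀, θ', E', hf.trans h₁, h⟩

variable {F : PrimSem S P} {Γ Γ' : MethodSpec S M}

/-- Strong locality, for a command that does not fault on the smaller state. -/
theorem PrimSem.has_iff_of_op {c : P} {t : ThreadID} {σ₁ σ₂ σ : S} (h : op σ₁ σ₂ = some σ)
    (hne : F.f c t σ₁ ≠ .top) (σ' : S) :
    (F.f c t σ).Has σ' ↔ ∃ σ₁', (F.f c t σ₁).Has σ₁' ∧ op σ₁' σ₂ = some σ' := by
  cases hX : F.f c t σ₁ with
  | top => exact absurd hX hne
  | val X =>
    rw [F.strong_locality c t _ _ _ X h hX]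
    constructor
    · rintro ⟨σ₁', h₁, _, rfl, e⟩
      exact ⟨σ₁', h₁, e⟩
    · rintro ⟨σ₁', h₁, e⟩
      exact ⟨σ₁', h₁, _, rfl, e⟩

theorem Run.exists_base {ρ : List (Act S P M)} {σ θ E : S} (hσ : op θ E = some σ)
    (hrun : Run F Γ' ρ σ) (hsafe : SafeFrom F Γ (ρ.map Act.erase) θ)
    (hdom : ∀ t m, GAct.ret t m ∈ ρ.map Act.erase → m ∈ Γ.dom)
    {H : List (IAct S M)} (hH : extraHist Γ (history ρ) = some H) (hE : evalHist H E ≠ none) :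
    ∃ ρ₀ W, Run F Γ ρ₀ θ ∧ ρ₀.map Act.erase = ρ.map Act.erase ∧
      history ρ = W.map SplitAct.full ∧ history ρ₀ = W.map SplitAct.base ∧
      SplitEval Γ' W θ E := by
  induction ρ generalizing σ θ E H with
  | nil => exact ⟨[], [], trivial, rfl, rfl, rfl, trivial⟩
  | cons φ ρ ih =>
    obtain ⟨σ', hφ, hrun⟩ := hrun
    obtain ⟨hne, hsafe⟩ := hsafe
    have hdom' : ∀ t m, GAct.ret t m ∈ ρ.map Act.erase → m ∈ Γ.dom :=
      fun t m h => hdom t m (List.mem_cons_of_mem _ h)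
    rcases φ with ⟨t, c⟩ | ⟨t, m, s⟩ | ⟨t, m, s⟩
    · have hne' : F.f c t θ ≠ .top := by
        intro e
        apply hne
        simp only [Act.erase, evalAct, e]
      obtain ⟨θ', hθ', hσ'⟩ := (F.has_iff_of_op hσ hne' _).1 (evalAct_prim_has.1 hφ).1
      have hz : (evalAct F Γ (GAct.prim t c) θ).Has (θ', .prim t c) :=
        evalAct_prim_has.2 ⟨hθ', rfl⟩
      obtain ⟨ρ₀, W, h₁, h₂, h₃, h₄, h₅⟩ := ih hσ' hrun (hsafe _ hz) hdom' hH hE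
      refine ⟨.prim t c :: ρ₀, W, ⟨θ', hz, h₁⟩, ?_, h₃, h₄, h₅.of_footprint_eq ?_⟩
      · rw [List.map_cons, List.map_cons, h₂]
      · exact (F.footprint_preservation _ _ _ _ hθ').symm
    · obtain ⟨_, hs, e, he⟩ := evalAct_call_has.1 hφ
      cases he
      simp only [extraHist, history_cons_iface, List.mapM_cons, extraAct, Option.bind_eq_bind,
        Option.bind_eq_some_iff, Option.map_eq_some_iff, Option.pure_def,
        Option.some.injEq] at hH
      obtain ⟨_, ⟨a, ha, rfl⟩, H', hH', rfl⟩ := hH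
      obtain ⟨g, hg, hga⟩ := exists_mem_of_subPred_eq_some ha
      simp only [evalHist, List.foldlM_cons, evalIAct] at hE
      cases hEa : op E a with
      | none => simp [hEa] at hE
      | some E' =>
        rw [hEa] at hE
        -- Regrouping `(θ * E) * (g * a)` shows that `θ * g` is defined and compatible with the new
        -- extra state.
        have key : ((some θ * some g) * (some E * some a) : Option S) = some σ' := by
          rw [mul_mul_mul_comm, some_mul_some θ, hσ, some_mul_some g, hga]
          exact e
        rw [some_mul_some E, hEa] at key
        obtain ⟨θ', _, hθ', h', hσ'⟩ := exists_of_mul_eq_some key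
        cases h'
        have hz : (evalAct F Γ (GAct.call t m) θ).Has (θ', .iface (.call t m g)) :=
          evalAct_call_has.2 ⟨g, hg, hθ', rfl⟩
        obtain ⟨ρ₀, W, h₁, h₂, h₃, h₄, h₅⟩ := ih hσ' hrun (hsafe _ hz) hdom' hH' hE
        refine ⟨.iface (.call t m g) :: ρ₀, .call t m g a s :: W, ⟨θ', hz, h₁⟩, ?_, ?_, ?_,
          θ, θ', E', rfl, hθ', hEa, ⟨_, hσ'⟩, hga, hs, h₅⟩
        · rw [List.map_cons, List.map_cons, h₂]; rfl
        · rw [history_cons_iface, h₃]; rfl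
        · rw [history_cons_iface, h₄]; rfl
    · obtain ⟨_, hs, _, e, he⟩ := evalAct_ret_has.1 hφ
      cases he
      simp only [extraHist, history_cons_iface, List.mapM_cons, extraAct, Option.bind_eq_bind,
        Option.bind_eq_some_iff, Option.map_eq_some_iff, Option.pure_def,
        Option.some.injEq] at hH
      obtain ⟨_, ⟨a, ha, rfl⟩, H', hH', rfl⟩ := hH
      obtain ⟨g, hg, hga⟩ := exists_mem_of_subPred_eq_some ha
      simp only [evalHist, List.foldlM_cons, evalIAct] at hE
      cases hEa : sub E a with
      | none => simp [hEa] at hE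
      | some E' =>
        rw [hEa] at hE
        rw [sub_eq_some_iff] at hEa
        have hsub : subPred θ (Γ.post m t) ≠ none := by
          intro h
          apply hne
          simp only [Act.erase, evalAct, h, if_true]
        obtain ⟨θ', hθ'⟩ := Option.ne_none_iff_exists'.1 hsub
        obtain ⟨g', hg', hgθ⟩ := exists_mem_of_subPred_eq_some hθ'
        have k₁ : (some g * (some a * some σ') : Option S) = some σ := by
          rw [← mul_assoc, some_mul_some g, hga]; exact e
        have k₂ : (some g' * (some θ' * some E) : Option S) = some σ := by
          rw [← mul_assoc, some_mul_some g', hgθ]; exact hσ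
        -- `g` comes from the state returned under `Γ'`, `g'` from safety under `Γ` at `θ`; both are
        -- substates of `σ`, so precision identifies them.
        obtain rfl : g = g' := by
          obtain ⟨_, x, e₁, _, hx⟩ := exists_of_mul_eq_some k₁
          obtain ⟨_, y, e₂, _, hy⟩ := exists_of_mul_eq_some k₂
          cases e₁; cases e₂
          exact Γ.post_precise m (hdom t m (by simp [Act.erase])) t _ _ _ _ _ hg hg' hx hy
        have hσ' : op θ' E' = some σ' := by
          have k₃ : (some s * (some θ' * some E') : Option S) = some σ := by
            rw [← hga, ← some_mul_some, ← k₂, ← hEa, ← some_mul_some]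
            ac_rfl
          exact mul_left_cancel_of_eq_some k₃ e
        have hz : (evalAct F Γ (GAct.ret t m) θ).Has (θ', .iface (.ret t m g)) :=
          evalAct_ret_has.2 ⟨g, hg, hθ', hgθ, rfl⟩
        obtain ⟨ρ₀, W, h₁, h₂, h₃, h₄, h₅⟩ := ih hσ' hrun (hsafe _ hz) hdom' hH' hE
        refine ⟨.iface (.ret t m g) :: ρ₀, .ret t m g a s :: W, ⟨θ', hz, h₁⟩, ?_, ?_, ?_,
          θ, θ', E', rfl, hgθ, hEa, hga, hs, h₅⟩
        · rw [List.map_cons, List.map_cons, h₂]; rfl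
        · rw [history_cons_iface, h₃]; rfl
        · rw [history_cons_iface, h₄]; rfl

/-- The hypotheses `hX`, `hy`, `hf` and `hc` are the invariant: the pieces multiply to `σ`, and `σ *
z` has the footprint of a state compatible with `E`. Regrouping pieces leaves their product
unchanged. -/
theorem PieceRun.exists_run (hS : FootprintCancellative S) {X : Multiset S}
    {ρ : List (Act S P M)} (h : PieceRun F Γ X ρ) {W : List (SplitAct S M)}
    (hW : history ρ = W.map SplitAct.base) {σ z y θ E ξ : S}
    (hX : (X.map some).prod = some σ) (hy : op σ z = some y) (hf : footprint y = footprint θ)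
    (hE : SplitEval Γ' W θ E) (hc : Compatible θ E) (hξ : op σ E = some ξ)
    (hsafe : SafeFrom F Γ' (ρ.map Act.erase) ξ)
    (hdom : ∀ t m, GAct.ret t m ∈ ρ.map Act.erase → m ∈ Γ'.dom) :
    ∃ ρ', Run F Γ' ρ' ξ ∧ ρ'.map Act.erase = ρ.map Act.erase ∧
      history ρ' = W.map SplitAct.full := by
  induction h generalizing W σ y θ E ξ with
  | nil X =>
    cases W with
    | nil => exact ⟨[], trivial, rfl, rfl⟩
    | cons w W => simp [history] at hW
  | comb h _ ih =>
    refine ih hW ?_ hy hf hE hc hξ hsafe hdom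
    rw [← hX, Multiset.map_cons, Multiset.map_cons, Multiset.map_cons, Multiset.prod_cons,
      Multiset.prod_cons, Multiset.prod_cons, ← mul_assoc, some_mul_some, h]
  | split h _ ih =>
    refine ih hW ?_ hy hf hE hc hξ hsafe hdom
    rw [← hX, Multiset.map_cons, Multiset.map_cons, Multiset.map_cons, Multiset.prod_cons,
      Multiset.prod_cons, Multiset.prod_cons, ← mul_assoc, some_mul_some, h]
  | @prim a a' t c X ρ h _ ih =>
    rw [Multiset.map_cons, Multiset.prod_cons] at hX
    obtain ⟨_, r, e, hr, har⟩ := exists_of_mul_eq_some hX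
    cases e
    have hne : F.f c t a ≠ .top := fun e => by rw [e] at h; exact h
    -- The command acts on the piece `a` alone; footprint preservation keeps its result compatible
    -- with the other pieces, `z` and `E`, and strong locality lifts the step to `σ` and then to
    -- `ξ`.
    obtain ⟨σ', hσ', fσ⟩ := exists_op_of_footprint_eq
      (F.footprint_preservation _ _ _ _ h).symm har
    obtain ⟨y', hy', fy⟩ := exists_op_of_footprint_eq fσ hy
    obtain ⟨ξ', hξ', -⟩ := exists_op_of_footprint_eq fσ hξ
    have hne' : F.f c t σ ≠ .top := by
      intro e
      have := (F.has_iff_of_op har hne σ').2 ⟨a', h, hσ'⟩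
      rw [e] at this
      exact this
    have hz : (evalAct F Γ' (GAct.prim t c) ξ).Has (ξ', .prim t c) :=
      evalAct_prim_has.2 ⟨(F.has_iff_of_op hξ hne' _).2
        ⟨σ', (F.has_iff_of_op har hne _).2 ⟨a', h, hσ'⟩, hξ'⟩, rfl⟩
    obtain ⟨ρ', h₁, h₂, h₃⟩ := ih hW
      (by rw [Multiset.map_cons, Multiset.prod_cons, hr]; exact hσ') hy' (fy.symm.trans hf) hE hc
      hξ' (hsafe.2 _ hz) (fun t m h => hdom t m (List.mem_cons_of_mem _ h))
    exact ⟨.prim t c :: ρ', ⟨ξ', hz, h₁⟩, by rw [List.map_cons, List.map_cons, h₂], h₃⟩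
  | @call g t m X ρ h _ ih =>
    cases W with
    | nil => simp [history] at hW
    | cons w W =>
    rw [history_cons_iface, List.map_cons, List.cons.injEq] at hW
    obtain ⟨hw, hW⟩ := hW
    cases w with
    | ret => cases hw
    | call t' m' g' a s =>
    cases hw
    obtain ⟨θ₀, θ', E', f₀, hθ', hEa, hc', hga, hs, hE⟩ := hE
    -- `L₁` could accept `g`, so `y = σ * z` can too; definedness of `σ * g`, also next to `E'`,
    -- follows by dropping `z`.
    obtain ⟨y', hy', fy⟩ := exists_op_of_footprint_eq (f₀.symm.trans hf.symm) hθ'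
    obtain ⟨v, hv⟩ := (compatible_iff_of_footprint_eq fy E').1 hc'
    have e₁ : ((some g * some σ) * some z : Option S) = some y' := by
      rw [← hy', ← some_mul_some y, ← hy, ← some_mul_some σ]
      ac_rfl
    obtain ⟨σ', _, hσ', e, hy''⟩ := exists_of_mul_eq_some e₁
    cases e
    have e₂ : ((some σ' * some E') * some z : Option S) = some v := by
      rw [mul_right_comm, some_mul_some σ', hy'', some_mul_some, hv]
    obtain ⟨ξ', _, hξ', e, -⟩ := exists_of_mul_eq_some e₂
    cases e
    have hz : (evalAct F Γ' (GAct.call t m) ξ).Has (ξ', .iface (.call t m s)) := by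
      refine evalAct_call_has.2 ⟨s, hs, ?_, rfl⟩
      change op ξ s = some ξ'
      rw [← hξ', ← some_mul_some, ← hξ, ← hga, ← hσ', ← hEa]
      simp only [← some_mul_some]
      ac_rfl
    obtain ⟨ρ', h₁, h₂, h₃⟩ := ih hW
      (by rw [Multiset.map_cons, Multiset.prod_cons, hX]; exact hσ') hy'' fy.symm hE hc'
      hξ' (hsafe.2 _ hz) (fun t m h => hdom t m (List.mem_cons_of_mem _ h))
    refine ⟨.iface (.call t m s) :: ρ', ⟨ξ', hz, h₁⟩, ?_, ?_⟩
    · rw [List.map_cons, List.map_cons, h₂]; rfl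
    · rw [history_cons_iface, h₃]; rfl
  | @ret g t m X ρ h _ ih =>
    cases W with
    | nil => simp [history] at hW
    | cons w W =>
    rw [history_cons_iface, List.map_cons, List.cons.injEq] at hW
    obtain ⟨hw, hW⟩ := hW
    cases w with
    | call => cases hw
    | ret t' m' g' a s =>
    cases hw
    obtain ⟨θ₀, θ', E', f₀, hθ', hEa, hga, hs, hE⟩ := hE
    rw [Multiset.map_cons, Multiset.prod_cons] at hX
    obtain ⟨_, r, e, hr, hgr⟩ := exists_of_mul_eq_some hX
    cases e
    have e₁ : (some g * (some r * some z) : Option S) = some y := by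
      rw [← mul_assoc, some_mul_some g, hgr]; exact hy
    obtain ⟨_, y', e, hy', hgy⟩ := exists_of_mul_eq_some e₁
    cases e
    -- Cancellativity on footprints: the same `g` is removed from two states of equal footprint.
    have fy : footprint y' = footprint θ' := hS _ _ _ _ _ _ hgy hθ' (hf.trans f₀) rfl
    have e₂ : (some s * (some r * some E') : Option S) = some ξ := by
      rw [← hga, ← hξ, ← some_mul_some σ, ← hgr, ← hEa]
      simp only [← some_mul_some]
      ac_rfl
    obtain ⟨_, ξ', e, hξ', hsξ⟩ := exists_of_mul_eq_some e₂
    cases e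
    obtain ⟨v, hv⟩ := (compatible_iff_of_footprint_eq f₀ E).1 hc
    have e₃ : ((some θ' * some E') * (some g * some a) : Option S) = some v := by
      rw [← hv, ← some_mul_some, ← hEa, ← hθ']
      simp only [← some_mul_some]
      ac_rfl
    obtain ⟨v', _, hv', -, -⟩ := exists_of_mul_eq_some e₃
    have hpr := Γ'.post_precise m (hdom t m (by simp [Act.erase])) t
    have hz : (evalAct F Γ' (GAct.ret t m) ξ).Has (ξ', .iface (.ret t m s)) :=
      evalAct_ret_has.2 ⟨s, hs, (subPred_eq_some_iff hpr _ _).2 ⟨s, hs, hsξ⟩, hsξ, rfl⟩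
    obtain ⟨ρ', h₁, h₂, h₃⟩ := ih hW hr hy' fy hE ⟨v', hv'⟩
      hξ' (hsafe.2 _ hz) (fun t m h => hdom t m (List.mem_cons_of_mem _ h))
    refine ⟨.iface (.ret t m s) :: ρ', ⟨ξ', hz, h₁⟩, ?_, ?_⟩
    · rw [List.map_cons, List.map_cons, h₂]; rfl
    · rw [history_cons_iface, h₃]; rfl

end Frame

end OwnershipLin

/-! ### The frame rule -/

theorem mainTheorem3 {S : Type*} [SepAlgebra S] (hS : FootprintCancellative S)
    {P : Type*} {M : Type*} (F : PrimSem S P)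
    (Γ Γ' : MethodSpec S M) (L₁ L₂ : Library P M)
    (hL₁ : Specifies Γ L₁) (hL₂ : Specifies Γ L₂)
    (I₁ I₂ I : Set S)
    (hext : Extends Γ' Γ)
    (hsafe₁ : SafeFor F L₁ Γ I₁) (hsafe₁' : SafeFor F L₁ Γ' (sepConj I₁ I))
    (hsafe₂ : SafeFor F L₂ Γ I₂) (hsafe₂' : SafeFor F L₂ Γ' (sepConj I₂ I))
    (hlin : LinearizedBy F Γ L₁ I₁ L₂ I₂)
    (hextra : ∀ σ₀ ∈ I₁, ∀ σ₀' ∈ I, ∀ σ, SepAlgebra.op σ₀ σ₀' = some σ →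
      ∀ τ, (denot F L₁ Γ' σ).Has τ →
        ∃ H, extraHist Γ (history τ) = some H ∧ evalHist H σ₀' ≠ none) :
    LinearizedBy F Γ' L₁ (sepConj I₁ I) L₂ (sepConj I₂ I) := by
  rintro _ ⟨σ, ⟨σ₁, hσ₁, E, hE, hσ⟩, τ, hτ, rfl⟩
  obtain ⟨H, hH, hev⟩ := hextra σ₁ hσ₁ E hE σ hσ τ hτ
  obtain ⟨hτL, hrun⟩ := (denot_has_iff (hsafe₁' σ ⟨σ₁, hσ₁, E, hE, hσ⟩) τ).1 hτ
  obtain ⟨τ₁, W, hrun₁, herase, hfull, hbase, hsplit⟩ := hrun.exists_base hσ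
    (safeFrom_of_denot_ne_top (hsafe₁ σ₁ hσ₁) hτL)
    (fun t m h => hL₁ m (L₁.mem_methods_of_ret_mem hτL h)) hH hev
  obtain ⟨_, ⟨σ₂, hσ₂, τ₂, hτ₂, rfl⟩, ⟨_, a, b, z, fa, fb, hab, -⟩, hHL⟩ :=
    hlin (footprint σ₁, history τ₁) ⟨σ₁, hσ₁, τ₁,
      (denot_has_iff (hsafe₁ σ₁ hσ₁) τ₁).2 ⟨herase ▸ hτL, hrun₁⟩, rfl⟩
  dsimp only at fa fb hHL
  obtain ⟨hτL₂, hrun₂⟩ := (denot_has_iff (hsafe₂ σ₂ hσ₂) τ₂).1 hτ₂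
  -- The footprint order supplies the remainder `z`: `σ₂ * z` has the footprint of `σ₁`. Hence it is
  -- compatible with `E`, and dropping `z` gives the initial state `ξ = σ₂ * E`, while `ξ * z` has
  -- the footprint of `σ`.
  obtain ⟨y, hy, fy⟩ := exists_op_of_footprint_eq fa.symm hab
  have hyσ : footprint y = footprint σ₁ := fy.symm.trans fb.symm
  obtain ⟨v, hv, fv⟩ := exists_op_of_footprint_eq hyσ.symm hσ
  have e : ((some σ₂ * some E) * some z : Option S) = some v := by
    rw [mul_right_comm, some_mul_some σ₂, hy, some_mul_some, hv]
  obtain ⟨ξ, _, hξ, e, hξz⟩ := exists_of_mul_eq_some e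
  cases e
  have hξI : ξ ∈ sepConj I₂ I := ⟨σ₂, hσ₂, E, hE, hξ⟩
  obtain ⟨K, K', hK, hKW, hK'⟩ := hHL.exists_keyedLin
  obtain ⟨ρ, hρ, hproj, hpr⟩ := hrun₂.pieceRun.exists_rearrangement hK hK'.symm
    (L₂.sequential_threadProj hτL₂)
  have hρL : ρ.map Act.erase ∈ L₂.traceSet :=
    L₂.mem_traceSet_of_threadProj_eq (fun t => (hproj t).symm) hτL₂
  obtain ⟨τ', hrun', herase', hhist⟩ := hpr.exists_run hS (Γ' := Γ')
    (hρ.trans (hKW.trans hbase)) (by simp) hy hyσ hsplit ⟨σ, hσ⟩ hξ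
    (safeFrom_of_denot_ne_top (hsafe₂' ξ hξI) hρL)
    (fun t m h => hext.1 ▸ hL₂ m (L₂.mem_methods_of_ret_mem hρL h))
  refine ⟨(footprint ξ, history τ'), ⟨ξ, hξI, τ',
    (denot_has_iff (hsafe₂' ξ hξI) τ').2 ⟨herase' ▸ hρL, hrun'⟩, rfl⟩,
    ⟨_, ξ, v, z, rfl, fv, hξz, rfl⟩, ?_⟩
  dsimp only
  rw [hfull, hhist]
  -- All reordering was done inside the trace of `L₂`, so the two histories coincide.
  exact HistLin.refl _
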